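/- Notation. Let $P(s)=\sum_p p^{-s}$ (sum over primes, $\operatorname{Re}s>1$), and let $(s_j)$ be a sequence of zeros of the Riemann zeta function with $0<\operatorname{Re}s_j<1$. Put $d_n=(\operatorname{Im}s_{n+1}-\operatorname{Im}s_n)/2$ and $$D(n,\varepsilon)=\{s:\varepsilon<\operatorname{Re}s<1-\varepsilon,\ \operatorname{Im}s\ne\operatorname{Im}s_n,\ \operatorname{Im}s_n-d_n\le\operatorname{Im}s\le\operatorname{Im}s_n+d_n\}.$$ Let $m\ge1$ be an integer, $\varepsilon>2/m$, $a>2$, and let $\alpha\in\mathbb R$ be such that $\tfrac34+i\alpha\in D(n,\varepsilon)$. Suppose that $\zeta$ has no zero on the segment $\varepsilon<\operatorname{Re}s<1-\varepsilon$, $\operatorname{Im}s=\alpha$. Let $$F(s)=\tfrac s2\ln\pi-\ln\Gamma(\tfrac s2)-\tfrac{1-s}2\ln\pi+\ln\Gamma(\tfrac{1-s}2),$$ with $\ln\Gamma$ the holomorphic branch on $\operatorname{Re}z>0$ with $\ln\Gamma(1)=0$. Let $\ln\zeta$ be a continuous branch of the logarithm on the two segments $\varepsilon<\operatorname{Re}s<1-\varepsilon$,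 $\operatorname{Im}s=\pm\alpha$, with the relative multiple of $2\pi i$ on the two segments fixed so that $\ln\zeta(s)=\ln\zeta(1-s)+F(s)$ holds at one point $s$ of the segment $\operatorname{Im}s=\alpha$. Put $$Q_m(s)=\ln\zeta(s)-\sum_{j\ge m}\frac{P(js)}j,\qquad F_m(s)=F(s)-\sum_{j\ge m}\frac{P(js)}j+\sum_{j\ge m}\frac{P(j(1-s))}j .$$ Let $\nu_\varepsilon$ be the indicator function of $(2\varepsilon,\tfrac12-2\varepsilon)\cup(\tfrac12+2\varepsilon,1-2\varepsilon)$, let $\psi(t)=\sigma e^{1/(t^2-1)}$ for $t^2<1$ and $\psi(t)=0$ otherwise, with $\sigma$ chosen so that $\int\psi=1$, and let $\mu_\varepsilon(x)=\frac1\varepsilon\int\psi(t/\varepsilon)\,\nu_\varepsilon(x-t)\,dt$. Put $Q_\varepsilon(s)=Q_m(s)\mu_\varepsilon(\operatorname{Re}s)$, $F_\varepsilon(s)=F_m(s)\mu_\varepsilon(\operatorname{Re}s)$ and, for $k\in\mathbb C$, $$I_\varepsilon(k)=\frac1{\sqrt{2\pi}}\int_\varepsilon^{1-\varepsilon}Q_\varepsilon(\tau+i\alpha)e^{-ik\tau}d\tau,\quad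 J_\varepsilon(k)=\frac1{\sqrt{2\pi}}\int_\varepsilon^{1-\varepsilon}Q_\varepsilon(\tau-i\alpha)e^{ik\tau}d\tau,\quad \widetilde F_\varepsilon(k)=\frac1{\sqrt{2\pi}}\int_\varepsilon^{1-\varepsilon}F_\varepsilon(\tau+i\alpha)e^{-ik\tau}d\tau .$$ Let $R(k)=\dfrac{e^{-ik}}{k-ia}+1$. For a function $f$ on $\mathbb R$ and $k\in\mathbb R$ let $T_\pm f(k)=\lim_{z\to k,\ \pm\operatorname{Im}z>0}\frac1{2\pi i}\int_{-\infty}^{\infty}\frac{f(t)}{t-z}dt$. Put $\Gamma_\pm=-T_\pm(\ln R)$ (principal logarithm on $\mathbb R$), $X_\pm=e^{\Gamma_\pm}$ and $G_\varepsilon=J_\varepsilon$. Theorem. The integrals defining $I_\varepsilon,J_\varepsilon,\widetilde F_\varepsilon$ converge absolutely, and the following hold. (1) The functions $\Psi_+=J_\varepsilon$ and $\Psi_-=\dfrac{I_\varepsilon-\widetilde F_\varepsilon}{k-ia}$ solve the scalar Riemann–Hilbert problem with coefficient $R$: $\Psi_+$ (respectively $\Psi_-$) is holomorphic in the open upper (respectively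 lower) half plane, continuous on the closed half plane, and tends to $0$ as $|k|\to\infty$ in it, and $$\Psi_-(k)=R(k)\Psi_+(k)-G_\varepsilon(k)\qquad(k\in\mathbb R).$$ (2) On $\mathbb R$ the boundary values $\Gamma_\pm$ exist and $R=X_- /X_+$. (3) On $\mathbb R$ the boundary values $T_\pm(G_\varepsilon/X_-)$ exist, and $$J_\varepsilon=X_+\,T_+\!\left(\frac{G_\varepsilon}{X_-}\right),\qquad \frac{I_\varepsilon-\widetilde F_\varepsilon}{k-ia}=X_-\,T_-\!\left(\frac{G_\varepsilon}{X_-}\right).$$ Here the Cauchy integrals in (2) and (3) converge absolutely for non-real $z$. -/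

import Mathlib

open Complex Filter Topology MeasureTheory

noncomputable section

namespace ZetaRH

/-- Prime zeta function `P(s) = ∑_p p^{-s}` (used for `Re s > 1` only). -/
def primeZeta (s : ℂ) : ℂ := ∑' p : Nat.Primes, 1 / ((p : ℕ) : ℂ) ^ s

/-- `∑_{n ≥ m} P(n s) / n`. -/
def primeTail (m : ℕ) (s : ℂ) : ℂ :=
  ∑' j : ℕ, primeZeta (((m + j : ℕ) : ℂ) * s) / ((m + j : ℕ) : ℂ)

/-- The standard logarithm of the Gamma function on the half plane `Re z > 0`: the primitive of
`Γ'/Γ` that vanishes at `1`, integrated along the segment from `1` to `z`. -/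
def logGamma (z : ℂ) : ℂ :=
  ∫ t in (0 : ℝ)..1, (z - 1) * Complex.digamma (1 + (t : ℂ) * (z - 1))

/-- `F(s) = (s/2) ln π - ln Γ(s/2) - ((1-s)/2) ln π + ln Γ((1-s)/2)`. -/
def F (s : ℂ) : ℂ :=
  s / 2 * (Real.log Real.pi : ℂ) - logGamma (s / 2)
    - (1 - s) / 2 * (Real.log Real.pi : ℂ) + logGamma ((1 - s) / 2)

/-- `F_m(s) = F(s) - ∑_{n ≥ m} P(n s)/n + ∑_{n ≥ m} P(n (1-s))/n`. -/
def Fm (m : ℕ) (s : ℂ) : ℂ := F s - primeTail m s + primeTail m (1 - s)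

/-- `Q_m(s) = ln ζ(s) - ∑_{n ≥ m} P(n s)/n`, with `L` the chosen branch of `ln ζ`. -/
def Qm (L : ℂ → ℂ) (m : ℕ) (s : ℂ) : ℂ := L s - primeTail m s

/-- Half of the difference of the ordinates of `s_{n+1}` and `s_n`. -/
def halfGap (s : ℕ → ℂ) (n : ℕ) : ℝ := ((s (n + 1)).im - (s n).im) / 2

/-- The set `D(n, ε)` attached to the sequence of zeros `s`. -/
def D (s : ℕ → ℂ) (n : ℕ) (ε : ℝ) : Set ℂ :=
  {z | ε < z.re ∧ z.re < 1 - ε ∧ z.im ≠ (s n).im ∧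
    (s n).im - halfGap s n ≤ z.im ∧ z.im ≤ (s n).im + halfGap s n}

/-- The open horizontal segment `ε < Re z < 1 - ε` at height `β`. -/
def hseg (ε β : ℝ) : Set ℂ := {z | ε < z.re ∧ z.re < 1 - ε ∧ z.im = β}

/-- `L` is a branch of `ln ζ` on the mirror-symmetric segments at heights `α` and `-α`:
it is continuous there and `exp L = ζ`. A branch is only determined up to a multiple of `2πi` on
each of the two segments; the last clause fixes the relative multiple, at one point, so that the
logarithm is compatible with Riemann's functional equation. -/
structure IsLogZetaBranch (L : ℂ → ℂ) (ε α : ℝ) : Prop where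
  continuousOn : ContinuousOn L (hseg ε α ∪ hseg ε (-α))
  exp_eq : ∀ z ∈ hseg ε α ∪ hseg ε (-α), Complex.exp (L z) = riemannZeta z
  normalized : ∃ z ∈ hseg ε α, L z = L (1 - z) + F z

/-- The step function `ν_ε`: the indicator of `(2ε, 1/2 - 2ε) ∪ (1/2 + 2ε, 1 - 2ε)`. -/
def nu (ε : ℝ) : ℝ → ℝ :=
  Set.indicator (Set.Ioo (2 * ε) (1 / 2 - 2 * ε) ∪ Set.Ioo (1 / 2 + 2 * ε) (1 - 2 * ε))
    (fun _ => 1)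

/-- The standard mollifier, of integral one, supported in `[-1, 1]`. -/
def psi (t : ℝ) : ℝ :=
  if t ^ 2 < 1 then
    (∫ u in (-1 : ℝ)..1, Real.exp (1 / (u ^ 2 - 1)))⁻¹ * Real.exp (1 / (t ^ 2 - 1))
  else 0

/-- `μ_ε(x) = (1/ε) ∫ ψ(t/ε) ν_ε(x - t) dt`. -/
def mu (ε x : ℝ) : ℝ := (1 / ε) * ∫ t : ℝ, psi (t / ε) * nu ε (x - t)

/-- `Q_ε(s) = Q_m(s) μ_ε(Re s)`. -/
def Qeps (L : ℂ → ℂ) (m : ℕ) (ε : ℝ) (s : ℂ) : ℂ := Qm L m s * (mu ε s.re : ℂ)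

/-- `F_ε(s) = F_m(s) μ_ε(Re s)`. -/
def Feps (m : ℕ) (ε : ℝ) (s : ℂ) : ℂ := Fm m s * (mu ε s.re : ℂ)

/-- `I_ε(k, α) = (2π)^{-1/2} ∫_ε^{1-ε} Q_ε(τ + iα) e^{-ikτ} dτ`, for complex `k`. -/
def Ieps (L : ℂ → ℂ) (m : ℕ) (ε α : ℝ) (k : ℂ) : ℂ :=
  1 / (Real.sqrt (2 * Real.pi) : ℂ) *
    ∫ τ in ε..(1 - ε), Qeps L m ε ((τ : ℂ) + α * I) * Complex.exp (-I * k * τ)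

/-- `J_ε(k, α) = (2π)^{-1/2} ∫_ε^{1-ε} Q_ε(τ - iα) e^{ikτ} dτ`, for complex `k`. -/
def Jeps (L : ℂ → ℂ) (m : ℕ) (ε α : ℝ) (k : ℂ) : ℂ :=
  1 / (Real.sqrt (2 * Real.pi) : ℂ) *
    ∫ τ in ε..(1 - ε), Qeps L m ε ((τ : ℂ) - α * I) * Complex.exp (I * k * τ)

/-- `F̃_ε(k, α) = (2π)^{-1/2} ∫_ε^{1-ε} F_ε(τ + iα) e^{-ikτ} dτ`, for complex `k`. -/
def Ftilde (m : ℕ) (ε α : ℝ) (k : ℂ) : ℂ :=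
  1 / (Real.sqrt (2 * Real.pi) : ℂ) *
    ∫ τ in ε..(1 - ε), Feps m ε ((τ : ℂ) + α * I) * Complex.exp (-I * k * τ)

/-- `R(k) = e^{-ik} / (k - ia) + 1`. -/
def R (a : ℝ) (k : ℂ) : ℂ := Complex.exp (-I * k) / (k - a * I) + 1

/-- Open upper half plane. -/
def upper : Set ℂ := {z | 0 < z.im}

/-- Open lower half plane. -/
def lower : Set ℂ := {z | z.im < 0}

/-- Cauchy integral `(1/2πi) ∫_ℝ f(t)/(t - z) dt`. -/
def cauchyInt (f : ℝ → ℂ) (z : ℂ) : ℂ :=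
  1 / (2 * Real.pi * I) * ∫ t : ℝ, f t / ((t : ℂ) - z)

/-- `T_+ f (k)`: boundary value at `k` of the Cauchy integral from the upper half plane. -/
def Tplus (f : ℝ → ℂ) (k : ℝ) : ℂ := limUnder (𝓝[upper] (k : ℂ)) (cauchyInt f)

/-- `T_- f (k)`: boundary value at `k` of the Cauchy integral from the lower half plane. -/
def Tminus (f : ℝ → ℂ) (k : ℝ) : ℂ := limUnder (𝓝[lower] (k : ℂ)) (cauchyInt f)

/-- `T_+ f (k)` is meaningful: the Cauchy integrals converge absolutely and the limit exists. -/
def TplusExists (f : ℝ → ℂ) (k : ℝ) : Prop :=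
  (∀ z ∈ upper, Integrable fun t : ℝ => f t / ((t : ℂ) - z)) ∧
    Tendsto (cauchyInt f) (𝓝[upper] (k : ℂ)) (𝓝 (Tplus f k))

/-- `T_- f (k)` is meaningful: the Cauchy integrals converge absolutely and the limit exists. -/
def TminusExists (f : ℝ → ℂ) (k : ℝ) : Prop :=
  (∀ z ∈ lower, Integrable fun t : ℝ => f t / ((t : ℂ) - z)) ∧
    Tendsto (cauchyInt f) (𝓝[lower] (k : ℂ)) (𝓝 (Tminus f k))

/-- `ln R` on the real line (principal logarithm). -/
def lnR (a : ℝ) (t : ℝ) : ℂ := Complex.log (R a t)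

/-- `Γ_+(k) = -(1/2πi) ∫ ln R(t) / (t - k - i0) dt`. -/
def GammaPlus (a : ℝ) (k : ℝ) : ℂ := -Tplus (lnR a) k

/-- `Γ_-(k) = -(1/2πi) ∫ ln R(t) / (t - k + i0) dt`. -/
def GammaMinus (a : ℝ) (k : ℝ) : ℂ := -Tminus (lnR a) k

/-- `X_+ = exp Γ_+`. -/
def Xplus (a : ℝ) (k : ℝ) : ℂ := Complex.exp (GammaPlus a k)

/-- `X_- = exp Γ_-`. -/
def Xminus (a : ℝ) (k : ℝ) : ℂ := Complex.exp (GammaMinus a k)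

/-- `(Ψ₊, Ψ₋)` solves the scalar Riemann–Hilbert problem `Ψ₋ = A Ψ₊ + g` on the real line:
`Ψ₊` (`Ψ₋`) is holomorphic in the open upper (lower) half plane, continuous up to the real line,
and tends to zero at infinity in the closed half plane. -/
structure IsRHSolution (A g : ℝ → ℂ) (Ψp Ψm : ℂ → ℂ) : Prop where
  holo_plus : DifferentiableOn ℂ Ψp upper
  holo_minus : DifferentiableOn ℂ Ψm lower
  cont_plus : ContinuousOn Ψp {z | 0 ≤ z.im}
  cont_minus : ContinuousOn Ψm {z | z.im ≤ 0}
  jump : ∀ k : ℝ, Ψm k = A k * Ψp k + g k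
  decay_plus : Tendsto Ψp (Bornology.cobounded ℂ ⊓ 𝓟 {z | 0 ≤ z.im}) (𝓝 0)
  decay_minus : Tendsto Ψm (Bornology.cobounded ℂ ⊓ 𝓟 {z | z.im ≤ 0}) (𝓝 0)

end ZetaRH

end

namespace ZetaRH

/-! The Riemann–Hilbert problem factorizes explicitly. Since `a > 2`, the quotient `e^{-ik}/(k -
ia)` has modulus at most `1/2` on the closed lower half plane, so `log R` is holomorphic in the open
lower half plane, continuous up to the real line, and `O(1/|k - ia|)`. Its Cauchy integral therefore
vanishes above the line and equals `-log R` below it, which gives `X₊ = 1` and `X₋ = R`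
(`Xplus_eq_one`, `Xminus_eq_R`).

The relation between `I`, `J` and `F̃` is the functional equation. Both sides of its logarithm are
continuous on the segment with equal exponentials, so agreement at one point propagates
(`IsLogZetaBranch.eqOn`). As `μ_ε` is symmetric about `1/2`, this gives `F_ε(s) = Q_ε(s) - Q_ε(1 -
s)`, and the substitution `τ ↦ 1 - τ` turns `I - F̃` into `e^{-ik} J`. Hence `Ψ₋ = (R - 1) J`, and
`J / X₋ = J - Ψ₋ / R` splits into an upper and a lower boundary function. The Plemelj formulas
`tplus_sub` and `tminus_sub` read off the two parts (`plemelj_of_jump`).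

The analytic input is that `Q_ε` is continuous on the closed interval, including at endpoints where
`ζ` may vanish: there `ln ζ` grows logarithmically while `μ_ε` vanishes linearly
(`continuousOn_log_mul_mu`). Then `J` lies in `L²` on the real line by Plancherel and tends to zero
in the closed upper half plane by a uniform Riemann–Lebesgue lemma. -/

/-! ### Half planes and the Cauchy kernel on the real line. -/

theorem isOpen_upper : IsOpen upper := isOpen_lt continuous_const continuous_im

instance neBot_nhdsWithin_upper (k : ℝ) : (𝓝[upper] (k : ℂ)).NeBot := by
  rw [← mem_closure_iff_nhdsWithin_neBot]
  have h : closure upper = {z : ℂ | 0 ≤ z.im} := closure_setOfPred_lt_im 0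
  rw [h]
  simp

instance neBot_nhdsWithin_lower (k : ℝ) : (𝓝[lower] (k : ℂ)).NeBot := by
  rw [← mem_closure_iff_nhdsWithin_neBot]
  have h : closure lower = {z : ℂ | z.im ≤ 0} := closure_setOfPred_im_lt 0
  rw [h]
  simp

theorem ofReal_sub_ne_zero {z : ℂ} (hz : z.im ≠ 0) (t : ℝ) : (t : ℂ) - z ≠ 0 := fun h => by
  rw [sub_eq_zero] at h
  rw [← h] at hz
  simp at hz

theorem normSq_ofReal_sub (z : ℂ) (hz : z.im ≠ 0) (t : ℝ) :
    normSq (t - z) = z.im ^ 2 * (1 + ((t - z.re) / z.im) ^ 2) := by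
  rw [normSq_apply]
  simp
  field_simp
  ring

theorem integrable_inv_normSq_ofReal_sub {z : ℂ} (hz : z.im ≠ 0) :
    Integrable fun t : ℝ => (normSq (t - z))⁻¹ := by
  simp_rw [normSq_ofReal_sub z hz, mul_inv]
  exact ((integrable_inv_one_add_sq.comp_div hz).comp_sub_right z.re).const_mul _

theorem integral_inv_normSq_ofReal_sub {z : ℂ} (hz : 0 < z.im) :
    ∫ t : ℝ, (normSq (t - z))⁻¹ = Real.pi / z.im := by
  simp_rw [normSq_ofReal_sub z hz.ne', mul_inv]
  rw [integral_const_mul, integral_sub_right_eq_self (fun t : ℝ => (1 + (t / z.im) ^ 2)⁻¹),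
    Measure.integral_comp_div (fun t : ℝ => (1 + t ^ 2)⁻¹), integral_univ_inv_one_add_sq,
    abs_of_pos hz]
  simp
  field_simp

theorem memLp_inv_ofReal_sub {z : ℂ} (hz : z.im ≠ 0) :
    MemLp (fun t : ℝ => ((t : ℂ) - z)⁻¹) 2 := by
  have hc : Continuous fun t : ℝ => ((t : ℂ) - z)⁻¹ :=
    (continuous_ofReal.sub continuous_const).inv₀ (ofReal_sub_ne_zero hz)
  rw [memLp_two_iff_integrable_sq_norm hc.aestronglyMeasurable]
  refine (integrable_inv_normSq_ofReal_sub hz).congr (.of_forall fun t => ?_)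
  simp [normSq_eq_norm_sq]

/-- Hölder with exponents `2, 2`; this is why square integrability is the condition imposed on
boundary values. -/
theorem integrable_div_ofReal_sub {f : ℝ → ℂ} (hf : MemLp f 2) {z : ℂ} (hz : z.im ≠ 0) :
    Integrable fun t : ℝ => f t / ((t : ℂ) - z) := by
  simp_rw [div_eq_mul_inv]
  exact hf.integrable_mul (memLp_inv_ofReal_sub hz)

theorem tendsto_inv_sub_cobounded (z : ℂ) :
    Tendsto (fun w : ℂ => (w - z)⁻¹) (Bornology.cobounded ℂ) (𝓝 0) := by
  have h := tendsto_inv₀_cobounded (α := ℂ)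
  refine h.comp ?_
  rw [← tendsto_norm_atTop_iff_cobounded]
  refine tendsto_atTop_mono (fun w => norm_sub_norm_le w z) ?_
  exact tendsto_atTop_add_const_right _ _ tendsto_norm_cobounded_atTop

theorem tendsto_div_sub_cobounded (z : ℂ) :
    Tendsto (fun w : ℂ => w / (w - z)) (Bornology.cobounded ℂ) (𝓝 1) := by
  have h := ((tendsto_inv_sub_cobounded z).const_mul z).const_add 1
  simp only [mul_zero, add_zero] at h
  refine h.congr' ?_
  filter_upwards [Bornology.eventually_ne_cobounded z] with w hw
  have : w - z ≠ 0 := sub_ne_zero.2 hw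
  field_simp
  ring

/-! ### Cauchy integrals of boundary functions. -/

/-- Cauchy's theorem on the upper half plane. -/
theorem integral_eq_zero_of_upper {H : ℂ → ℂ} (hc : ContinuousOn H {z | 0 ≤ z.im})
    (hd : DifferentiableOn ℂ H upper) (hi : Integrable fun t : ℝ => H t)
    (h0 : Tendsto (fun w => w * H w) (Bornology.cobounded ℂ ⊓ 𝓟 {z | 0 ≤ z.im}) (𝓝 0)) :
    ∫ t : ℝ, H t = 0 := by
  have hlim := intervalIntegral_tendsto_integral hi tendsto_neg_atTop_atBot tendsto_id
  refine tendsto_nhds_unique hlim ?_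
  rw [Metric.tendsto_atTop]
  intro δ hδ
  -- On the rectangle `[-T, T] × [0, T]` the top side has length `2T` and each vertical side length
  -- `T`, so a bound `δ / (8T)` on them gives at most `δ/2` in total.
  have h1 := (Metric.tendsto_nhds.1 h0) (δ / 8) (by positivity)
  rw [eventually_inf_principal, ← comap_norm_atTop, eventually_comap] at h1
  obtain ⟨N, hN⟩ := eventually_atTop.1 h1
  refine ⟨max N 1, fun T hT => ?_⟩
  have hT0 : 0 < T := lt_of_lt_of_le one_pos ((le_max_right _ _).trans hT)
  have hTN : N ≤ T := (le_max_left _ _).trans hT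
  have key : ∀ w : ℂ, 0 ≤ w.im → T ≤ ‖w‖ → ‖H w‖ ≤ δ / 8 / T := by
    intro w hw hTw
    have := hN ‖w‖ (hTN.trans hTw) w rfl hw
    rw [dist_zero_right, norm_mul] at this
    rw [le_div_iff₀ hT0]
    nlinarith [norm_nonneg (H w)]
  have hrect := integral_boundary_rect_eq_zero_of_continuousOn_of_differentiableOn H
    (-T : ℂ) (T + T * I) (hc.mono ?_) (hd.mono ?_)
  · simp only [neg_re, ofReal_re, neg_im, ofReal_im, neg_zero, ofReal_zero, zero_mul, add_zero,
      add_re, mul_re, I_re, mul_zero, I_im, mul_one, sub_self, add_im, mul_im, zero_add,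
      ofReal_neg] at hrect
    have e : (∫ x in -T..T, H x) = (∫ x in -T..T, H (x + T * I)) -
        I • (∫ y in (0:ℝ)..T, H (T + y * I)) + I • ∫ y in (0:ℝ)..T, H (-T + y * I) := by
      linear_combination hrect
    have n1 : ‖∫ x in -T..T, H (x + T * I)‖ ≤ δ / 8 / T * |T - -T| := by
      refine intervalIntegral.norm_integral_le_of_norm_le_const fun x _ => key _ (by simp [hT0.le]) ?_
      refine le_trans ?_ (abs_im_le_norm _)
      simp [abs_of_pos hT0]
    have n2 : ‖∫ y in (0:ℝ)..T, H (T + y * I)‖ ≤ δ / 8 / T * |T - 0| := by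
      refine intervalIntegral.norm_integral_le_of_norm_le_const fun x hx => key _ ?_ ?_
      · rw [Set.uIoc_of_le hT0.le] at hx
        simpa using hx.1.le
      · refine le_trans ?_ (abs_re_le_norm _)
        simp [abs_of_pos hT0]
    have n3 : ‖∫ y in (0:ℝ)..T, H (-T + y * I)‖ ≤ δ / 8 / T * |T - 0| := by
      refine intervalIntegral.norm_integral_le_of_norm_le_const fun x hx => key _ ?_ ?_
      · rw [Set.uIoc_of_le hT0.le] at hx
        simpa using hx.1.le
      · refine le_trans ?_ (abs_re_le_norm _)
        simp [abs_of_pos hT0]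
    rw [dist_zero_right, id, e]
    have c1 : δ / 8 / T * |T - -T| = δ / 4 := by
      rw [abs_of_pos (by linarith)]; field_simp; ring
    have c2 : δ / 8 / T * |T - 0| = δ / 8 := by
      rw [abs_of_pos (by linarith)]; field_simp; ring
    rw [c1] at n1
    rw [c2] at n2 n3
    refine (norm_add_le _ _).trans_lt ?_
    rw [norm_smul, norm_I, one_mul]
    have := norm_sub_le (∫ x in -T..T, H (x + T * I)) (I • ∫ y in (0:ℝ)..T, H (T + y * I))
    rw [norm_smul, norm_I, one_mul] at this
    linarith
  · intro w hw
    have := hw.2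
    simp only [Set.mem_preimage, neg_im, ofReal_im, neg_zero, add_im, mul_im, ofReal_re, I_im,
      mul_one, I_re, mul_zero, add_zero, zero_add, Set.uIcc_of_le hT0.le] at this
    exact this.1
  · intro w hw
    have := hw.2
    simp only [Set.mem_preimage, neg_im, ofReal_im, neg_zero, add_im, mul_im, ofReal_re, I_im,
      mul_one, I_re, mul_zero, add_zero, zero_add, min_eq_left hT0.le] at this
    exact this.1

/-- Functions holomorphic in the upper half plane, continuous up to the real line, vanishing at
infinity, and square integrable on the real line. -/
structure IsUpperBoundary (f : ℂ → ℂ) : Prop where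
  cont : ContinuousOn f {z | 0 ≤ z.im}
  holo : DifferentiableOn ℂ f upper
  decay : Tendsto f (Bornology.cobounded ℂ ⊓ 𝓟 {z | 0 ≤ z.im}) (𝓝 0)
  memLp : MemLp (fun t : ℝ => f t) 2

/-- Functions holomorphic in the lower half plane, continuous up to the real line, vanishing at
infinity, and square integrable on the real line. -/
structure IsLowerBoundary (f : ℂ → ℂ) : Prop where
  cont : ContinuousOn f {z | z.im ≤ 0}
  holo : DifferentiableOn ℂ f lower
  decay : Tendsto f (Bornology.cobounded ℂ ⊓ 𝓟 {z | z.im ≤ 0}) (𝓝 0)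
  memLp : MemLp (fun t : ℝ => f t) 2

/-- The pole of `f w / (w - z)` lies below the real line, and `w f w / (w - z) → 0` because `f`
decays, so Cauchy's theorem applies. -/
theorem IsUpperBoundary.cauchyInt_lower {f : ℂ → ℂ} (hf : IsUpperBoundary f) {z : ℂ}
    (hz : z ∈ lower) : cauchyInt (fun t => f t) z = 0 := by
  have hz' : z.im < 0 := hz
  have hne : ∀ w : ℂ, 0 ≤ w.im → w - z ≠ 0 := fun w hw h => by
    rw [sub_eq_zero] at h
    rw [h] at hw
    linarith
  rw [cauchyInt, integral_eq_zero_of_upper (H := fun w => f w / (w - z)), mul_zero]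
  · exact hf.cont.div (by fun_prop) hne
  · exact hf.holo.div (by fun_prop) fun w hw => hne w (le_of_lt hw)
  · exact integrable_div_ofReal_sub hf.memLp hz'.ne
  · have := ((tendsto_div_sub_cobounded z).mono_left inf_le_left).mul hf.decay
    rw [mul_zero] at this
    refine this.congr fun w => ?_
    ring

/-- To remove the pole at `z` without losing decay, subtract `f z (z - z̄)/(w - z̄)` instead of the
constant `f z`: it takes the value `f z` at `w = z` and its pole is in the lower half plane. On the
real line the correction becomes a multiple of the Poisson kernel, whose integral is explicit. -/
theorem IsUpperBoundary.cauchyInt_upper {f : ℂ → ℂ} (hf : IsUpperBoundary f) {z : ℂ}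
    (hz : z ∈ upper) : cauchyInt (fun t => f t) z = f z := by
  have hz' : 0 < z.im := hz
  set z' : ℂ := (starRingEnd ℂ) z with hz'def
  have hzim : z'.im < 0 := by simp [hz'def, hz']
  have hne : ∀ w : ℂ, 0 ≤ w.im → w - z' ≠ 0 := fun w hw h => by
    rw [sub_eq_zero] at h
    rw [h] at hw
    linarith
  set N : ℂ → ℂ := fun w => f w - f z * (z - z') / (w - z') with hN
  have hNz : N z = 0 := by
    simp only [hN]
    rw [mul_div_cancel_right₀ _ (hne z hz'.le), sub_self]
  have hNd : DifferentiableOn ℂ N upper :=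
    hf.holo.sub ((differentiableOn_const _).div (by fun_prop) fun w hw => hne w (le_of_lt hw))
  have hNc : ContinuousOn N {z | 0 ≤ z.im} :=
    hf.cont.sub (continuousOn_const.div (by fun_prop) hne)
  have hslope : ∀ w, w ≠ z → dslope N z w = N w / (w - z) := fun w hw => by
    rw [dslope_of_ne _ hw, slope_def_field, hNz, sub_zero]
  have hreal : ∀ t : ℝ, dslope N z t =
      f t / (t - z) - f z * (z - z') * ((normSq (t - z))⁻¹ : ℝ) := fun t => by
    have h1 := ofReal_sub_ne_zero hz'.ne' t
    have h2 := hne t (by simp)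
    rw [hslope _ (sub_ne_zero.1 h1)]
    have h3 : ((normSq (t - z) : ℝ) : ℂ) = (t - z) * (t - z') := by
      rw [← mul_conj]; simp [hz'def]
    rw [ofReal_inv, h3]
    simp only [hN]
    field_simp
  have hup : upper ∈ 𝓝 z := isOpen_upper.mem_nhds hz
  have hI1 := integrable_div_ofReal_sub hf.memLp hz'.ne'
  have hI2 : Integrable fun t : ℝ => f z * (z - z') * ((normSq (t - z))⁻¹ : ℝ) :=
    (integrable_inv_normSq_ofReal_sub hz'.ne').ofReal.const_mul _
  have hzero : ∫ t : ℝ, dslope N z t = 0 := by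
    refine integral_eq_zero_of_upper ?_ ?_ ?_ ?_
    · have hup' : {z : ℂ | 0 ≤ z.im} ∈ 𝓝 z :=
        mem_of_superset hup fun w (hw : 0 < w.im) => hw.le
      rw [continuousOn_dslope hup']
      exact ⟨hNc, hNd.differentiableAt hup⟩
    · exact (Complex.differentiableOn_dslope hup).2 hNd
    · simp_rw [hreal]
      exact hI1.sub hI2
    · have h1 : Tendsto N (Bornology.cobounded ℂ ⊓ 𝓟 {z | 0 ≤ z.im}) (𝓝 0) := by
        have := hf.decay.sub (((tendsto_inv_sub_cobounded z').const_mul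
          (f z * (z - z'))).mono_left inf_le_left)
        simpa [hN, div_eq_mul_inv] using this
      have := ((tendsto_div_sub_cobounded z).mono_left inf_le_left).mul h1
      rw [mul_zero] at this
      refine this.congr' ?_
      refine Filter.Eventually.filter_mono inf_le_left ?_
      filter_upwards [Bornology.eventually_ne_cobounded z] with w hw
      rw [hslope w hw]
      ring
  simp_rw [hreal] at hzero
  rw [integral_sub hI1 hI2, integral_const_mul, integral_complex_ofReal,
    integral_inv_normSq_ofReal_sub hz', sub_eq_zero] at hzero
  rw [cauchyInt, hzero]
  have h4 : z - z' = 2 * z.im * I := by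
    rw [hz'def, sub_conj]; push_cast; ring
  have h5 : (z.im : ℂ) ≠ 0 := by exact_mod_cast hz'.ne'
  have h6 : (Real.pi : ℂ) ≠ 0 := by exact_mod_cast Real.pi_ne_zero
  rw [h4]
  push_cast
  field_simp

/-- The reflection `t ↦ -t` exchanges the half planes, so the lower statements follow from the upper
ones. -/
theorem cauchyInt_neg (f : ℝ → ℂ) (z : ℂ) :
    cauchyInt f z = -cauchyInt (fun t => f (-t)) (-z) := by
  rw [cauchyInt, cauchyInt, ← integral_neg_eq_self (fun t : ℝ => f t / ((t : ℂ) - z)),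
    ← mul_neg, ← integral_neg]
  congr 2
  ext t
  push_cast
  rw [← div_neg]
  congr 1
  ring

theorem tendsto_neg_cobounded_inf :
    Tendsto (fun z : ℂ => -z) (Bornology.cobounded ℂ ⊓ 𝓟 {z | 0 ≤ z.im})
      (Bornology.cobounded ℂ ⊓ 𝓟 {z | z.im ≤ 0}) := by
  refine Tendsto.inf ?_ ?_
  · exact tendsto_neg_cobounded
  · rw [tendsto_principal_principal]
    simp

theorem IsLowerBoundary.comp_neg {f : ℂ → ℂ} (hf : IsLowerBoundary f) :
    IsUpperBoundary fun z => f (-z) where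
  cont := hf.cont.comp continuous_neg.continuousOn fun z hz => by simpa using hz
  holo := hf.holo.comp differentiable_neg.differentiableOn fun z hz => by
    simpa [lower, upper] using hz
  decay := hf.decay.comp tendsto_neg_cobounded_inf
  memLp := by
    have := hf.memLp.comp_measurePreserving (Measure.measurePreserving_neg volume)
    simpa [Function.comp_def] using this

theorem IsLowerBoundary.cauchyInt_upper {f : ℂ → ℂ} (hf : IsLowerBoundary f) {z : ℂ}
    (hz : z ∈ upper) : cauchyInt (fun t => f t) z = 0 := by
  have := hf.comp_neg.cauchyInt_lower (z := -z) (by simpa [lower, upper] using hz)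
  rw [cauchyInt_neg]
  simpa using this

theorem IsLowerBoundary.cauchyInt_lower {f : ℂ → ℂ} (hf : IsLowerBoundary f) {z : ℂ}
    (hz : z ∈ lower) : cauchyInt (fun t => f t) z = -f z := by
  have := hf.comp_neg.cauchyInt_upper (z := -z) (by simpa [lower, upper] using hz)
  rw [cauchyInt_neg]
  simpa using this

theorem cauchyInt_sub {f g : ℝ → ℂ} (hf : MemLp f 2) (hg : MemLp g 2) {z : ℂ} (hz : z.im ≠ 0) :
    cauchyInt (fun t => f t - g t) z = cauchyInt f z - cauchyInt g z := by
  simp only [cauchyInt, sub_div]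
  rw [integral_sub (integrable_div_ofReal_sub hf hz) (integrable_div_ofReal_sub hg hz), mul_sub]

theorem IsUpperBoundary.tendsto {f : ℂ → ℂ} (hf : IsUpperBoundary f) (k : ℝ) :
    Tendsto f (𝓝[upper] (k : ℂ)) (𝓝 (f k)) :=
  (hf.cont k (by simp)).mono_left (nhdsWithin_mono _ fun z (hz : 0 < z.im) => hz.le)

theorem IsLowerBoundary.tendsto {f : ℂ → ℂ} (hf : IsLowerBoundary f) (k : ℝ) :
    Tendsto f (𝓝[lower] (k : ℂ)) (𝓝 (f k)) :=
  (hf.cont k (by simp)).mono_left (nhdsWithin_mono _ fun z (hz : z.im < 0) => hz.le)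

/-! ### Plemelj formulas. -/

/-- Plemelj formula, upper boundary value, for a difference of two boundary functions. -/
theorem tplus_sub {f g : ℂ → ℂ} (hf : IsUpperBoundary f) (hg : IsLowerBoundary g) (k : ℝ) :
    TplusExists (fun t : ℝ => f t - g t) k ∧ Tplus (fun t : ℝ => f t - g t) k = f k := by
  have h : Tendsto (cauchyInt fun t : ℝ => f t - g t) (𝓝[upper] (k : ℂ)) (𝓝 (f k)) := by
    refine (hf.tendsto k).congr' ?_
    filter_upwards [self_mem_nhdsWithin] with z hz
    rw [cauchyInt_sub hf.memLp hg.memLp (ne_of_gt hz), hf.cauchyInt_upper hz,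
      hg.cauchyInt_upper hz, sub_zero]
  have h' : Tplus (fun t : ℝ => f t - g t) k = f k := h.limUnder_eq
  refine ⟨⟨fun z hz => integrable_div_ofReal_sub (hf.memLp.sub hg.memLp) (ne_of_gt hz), ?_⟩, h'⟩
  rwa [h']

/-- Plemelj formula, lower boundary value, for a difference of two boundary functions. -/
theorem tminus_sub {f g : ℂ → ℂ} (hf : IsUpperBoundary f) (hg : IsLowerBoundary g) (k : ℝ) :
    TminusExists (fun t : ℝ => f t - g t) k ∧ Tminus (fun t : ℝ => f t - g t) k = g k := by
  have h : Tendsto (cauchyInt fun t : ℝ => f t - g t) (𝓝[lower] (k : ℂ)) (𝓝 (g k)) := by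
    refine (hg.tendsto k).congr' ?_
    filter_upwards [self_mem_nhdsWithin] with z hz
    rw [cauchyInt_sub hf.memLp hg.memLp (ne_of_lt hz), hf.cauchyInt_lower hz,
      hg.cauchyInt_lower hz, zero_sub, neg_neg]
  have h' : Tminus (fun t : ℝ => f t - g t) k = g k := h.limUnder_eq
  refine ⟨⟨fun z hz => integrable_div_ofReal_sub (hf.memLp.sub hg.memLp) (ne_of_lt hz), ?_⟩, h'⟩
  rwa [h']

/-! ### The coefficient `R` and its factorization. -/

theorem le_norm_sub_mul_I {a : ℝ} {w : ℂ} (hw : w.im ≤ 0) : a ≤ ‖w - a * I‖ := by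
  refine le_trans ?_ (abs_im_le_norm _)
  refine le_trans ?_ (neg_le_abs _)
  simp
  linarith

theorem sub_mul_I_ne_zero {a : ℝ} (ha : 0 < a) {w : ℂ} (hw : w.im ≤ 0) : w - a * I ≠ 0 :=
  norm_pos_iff.1 (ha.trans_le (le_norm_sub_mul_I hw))

theorem norm_exp_neg_I_mul_le {w : ℂ} (hw : w.im ≤ 0) : ‖exp (-I * w)‖ ≤ 1 := by
  rw [norm_exp, Real.exp_le_one_iff]
  simpa using hw

theorem norm_exp_div_le {a : ℝ} {w : ℂ} (hw : w.im ≤ 0) :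
    ‖exp (-I * w) / (w - a * I)‖ ≤ ‖(w - a * I)⁻¹‖ := by
  rw [div_eq_mul_inv, norm_mul]
  exact mul_le_of_le_one_left (norm_nonneg _) (norm_exp_neg_I_mul_le hw)

theorem norm_exp_div_le_half {a : ℝ} (ha : 2 < a) {w : ℂ} (hw : w.im ≤ 0) :
    ‖exp (-I * w) / (w - a * I)‖ ≤ 1 / 2 := by
  refine (norm_exp_div_le hw).trans ?_
  rw [norm_inv, ← one_div]
  exact one_div_le_one_div_of_le two_pos (ha.le.trans (le_norm_sub_mul_I hw))

theorem half_le_norm_R {a : ℝ} (ha : 2 < a) {w : ℂ} (hw : w.im ≤ 0) : 1 / 2 ≤ ‖R a w‖ := by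
  have h := norm_exp_div_le_half ha hw
  have := norm_sub_norm_le (1 : ℂ) (-(exp (-I * w) / (w - a * I)))
  rw [norm_neg, norm_one, sub_neg_eq_add, add_comm (1 : ℂ)] at this
  rw [R]
  linarith

theorem R_ne_zero {a : ℝ} (ha : 2 < a) {w : ℂ} (hw : w.im ≤ 0) : R a w ≠ 0 :=
  norm_pos_iff.1 (lt_of_lt_of_le (by norm_num) (half_le_norm_R ha hw))

theorem R_mem_slitPlane {a : ℝ} (ha : 2 < a) {w : ℂ} (hw : w.im ≤ 0) : R a w ∈ slitPlane := by
  rw [R, add_comm]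
  exact mem_slitPlane_of_norm_lt_one ((norm_exp_div_le_half ha hw).trans_lt (by norm_num))

theorem differentiableAt_R {a : ℝ} (ha : 0 < a) {w : ℂ} (hw : w.im ≤ 0) :
    DifferentiableAt ℂ (R a) w := by
  have := sub_mul_I_ne_zero ha hw
  unfold R
  fun_prop (disch := assumption)

theorem tendsto_inv_sub_lower (a : ℝ) :
    Tendsto (fun w : ℂ => ‖(w - a * I)⁻¹‖) (Bornology.cobounded ℂ ⊓ 𝓟 {z | z.im ≤ 0}) (𝓝 0) :=
  tendsto_zero_iff_norm_tendsto_zero.1 ((tendsto_inv_sub_cobounded (a * I)).mono_left inf_le_left)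

/-- A function on the closed lower half plane dominated by `1 / |w - ia|` is a boundary function. -/
theorem isLowerBoundary_of_norm_le {a C : ℝ} (ha : 0 < a) {f : ℂ → ℂ}
    (hd : ∀ w : ℂ, w.im ≤ 0 → DifferentiableAt ℂ f w)
    (hC : ∀ w : ℂ, w.im ≤ 0 → ‖f w‖ ≤ C * ‖(w - a * I)⁻¹‖) : IsLowerBoundary f where
  cont w hw := (hd w hw).continuousAt.continuousWithinAt
  holo w hw := (hd w (le_of_lt hw)).differentiableWithinAt
  decay := by
    have h := (tendsto_inv_sub_lower a).const_mul C
    rw [mul_zero] at h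
    refine squeeze_zero_norm' ?_ h
    rw [eventually_inf_principal]
    exact .of_forall fun w hw => hC w hw
  memLp := by
    have hc : Continuous fun t : ℝ => f t := continuous_iff_continuousAt.2 fun t =>
      ContinuousAt.comp (f := fun t : ℝ => (t : ℂ)) (hd t (by simp)).continuousAt
        continuous_ofReal.continuousAt
    have hm := (memLp_inv_ofReal_sub (z := a * I) (by simpa using ha.ne')).norm.const_mul C
    exact hm.mono' hc.aestronglyMeasurable (.of_forall fun t => hC t (by simp))

/-- The constant `3/2` comes from `|log (1 + u)| ≤ (3/2) |u|` for `|u| ≤ 1/2`. The sign makes `ln R`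
the difference of the upper function `0` and this lower one. -/
theorem isLowerBoundary_log_R {a : ℝ} (ha : 2 < a) :
    IsLowerBoundary fun w => -log (R a w) := by
  refine isLowerBoundary_of_norm_le (a := a) (C := 3 / 2) (by linarith) (fun w hw => ?_)
    fun w hw => ?_
  · exact ((differentiableAt_R (by linarith) hw).clog (R_mem_slitPlane ha hw)).neg
  · rw [norm_neg, R, add_comm]
    refine (norm_log_one_add_half_le_self (norm_exp_div_le_half ha hw)).trans ?_
    gcongr
    exact norm_exp_div_le hw

theorem isUpperBoundary_zero : IsUpperBoundary fun _ => 0 where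
  cont := continuousOn_const
  holo := differentiableOn_const _
  decay := tendsto_const_nhds
  memLp := MemLp.zero'

theorem lnR_eq (a : ℝ) : lnR a = fun t : ℝ => 0 - -log (R a t) := by
  ext t
  simp [lnR]

theorem tplus_lnR {a : ℝ} (ha : 2 < a) (k : ℝ) :
    TplusExists (lnR a) k ∧ Tplus (lnR a) k = 0 := by
  rw [lnR_eq]
  exact tplus_sub isUpperBoundary_zero (isLowerBoundary_log_R ha) k

theorem tminus_lnR {a : ℝ} (ha : 2 < a) (k : ℝ) :
    TminusExists (lnR a) k ∧ Tminus (lnR a) k = -log (R a k) := by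
  rw [lnR_eq]
  exact tminus_sub isUpperBoundary_zero (isLowerBoundary_log_R ha) k

theorem Xplus_eq_one {a : ℝ} (ha : 2 < a) (k : ℝ) : Xplus a k = 1 := by
  rw [Xplus, GammaPlus, (tplus_lnR ha k).2, neg_zero, exp_zero]

theorem Xminus_eq_R {a : ℝ} (ha : 2 < a) (k : ℝ) : Xminus a k = R a k := by
  rw [Xminus, GammaMinus, (tminus_lnR ha k).2, neg_neg, exp_log (R_ne_zero ha (by simp))]

/-- Cauchy–Plemelj formulas for a pair with `Ψ₋ = (R - 1) Ψ₊`. -/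
theorem plemelj_of_jump {a C : ℝ} (ha : 2 < a) {f g : ℂ → ℂ} (hf : IsUpperBoundary f)
    (hgd : ∀ w : ℂ, w.im ≤ 0 → DifferentiableAt ℂ g w)
    (hgC : ∀ w : ℂ, w.im ≤ 0 → ‖g w‖ ≤ C * ‖(w - a * I)⁻¹‖)
    (hjump : ∀ k : ℝ, g k = R a k * f k - f k) (k : ℝ) :
    (TplusExists (fun t : ℝ => f t / Xminus a t) k ∧
      f k = Xplus a k * Tplus (fun t : ℝ => f t / Xminus a t) k) ∧
    (TminusExists (fun t : ℝ => f t / Xminus a t) k ∧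
      g k = Xminus a k * Tminus (fun t : ℝ => f t / Xminus a t) k) := by
  -- Dividing by `R` preserves the domination, at the cost of a factor `2`, because `|R| ≥ 1/2` on
  -- the closed lower half plane.
  have hg : IsLowerBoundary fun w => g w / R a w := by
    refine isLowerBoundary_of_norm_le (a := a) (C := 2 * C) (by linarith) (fun w hw => ?_)
      fun w hw => ?_
    · exact (hgd w hw).div (differentiableAt_R (by linarith) hw) (R_ne_zero ha hw)
    · rw [norm_div, div_le_iff₀ (norm_pos_iff.2 (R_ne_zero ha hw))]
      have h1 := half_le_norm_R ha hw
      have h2 := hgC w hw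
      nlinarith [norm_nonneg (g w)]
  have e : (fun t : ℝ => f t / Xminus a t) = fun t : ℝ => f t - g t / R a t := by
    ext t
    have := R_ne_zero ha (w := t) (by simp)
    rw [Xminus_eq_R ha, hjump]
    field_simp
    ring
  obtain ⟨hp, hp'⟩ := tplus_sub hf hg k
  obtain ⟨hm, hm'⟩ := tminus_sub hf hg k
  have := R_ne_zero ha (w := k) (by simp)
  rw [e, Xplus_eq_one ha, Xminus_eq_R ha, hp', hm']
  refine ⟨⟨hp, (one_mul _).symm⟩, hm, ?_⟩
  field_simp

/-! ### Fourier–Laplace integrals over a compact interval. -/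

/-- Plancherel: the Fourier integral of a function in `L¹ ∩ L²` is in `L²`. -/
theorem memLp_fourier {g : ℝ → ℂ} (h1 : Integrable g) (h2 : MemLp g 2) :
    MemLp (FourierTransform.fourier g : ℝ → ℂ) 2 := by
  have hcont : Continuous (FourierTransform.fourier g : ℝ → ℂ) :=
    VectorFourier.fourierIntegral_continuous Real.continuous_fourierChar
      (innerSL ℝ).continuous₂ h1
  -- `G` is the abstract `L²` transform. It is identified with the integral by testing against
  -- smooth compactly supported functions and moving the transform onto the test function on both
  -- sides.
  set G : Lp ℂ 2 (volume : Measure ℝ) := FourierTransform.fourier (h2.toLp g) with hG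
  have hae : ∀ᵐ x, (G : ℝ → ℂ) x = FourierTransform.fourier g x := by
    refine ae_eq_of_integral_contDiff_smul_eq ((Lp.memLp G).locallyIntegrable (by norm_num))
      hcont.locallyIntegrable fun φ hφ hφc => ?_
    have hφ1 : HasCompactSupport (Complex.ofRealCLM ∘ φ) := hφc.comp_left rfl
    have hφ2 : ContDiff ℝ (↑(⊤ : ℕ∞)) (Complex.ofRealCLM ∘ φ) := by fun_prop
    set Φ : SchwartzMap ℝ ℂ := hφ1.toSchwartzMap hφ2 with hΦ
    have hΦv : ∀ x, Φ x = φ x := fun x => by simp [hΦ]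
    have hd := congrArg (fun T => T Φ) (Lp.fourier_toTemperedDistribution_eq (h2.toLp g))
    simp only [TemperedDistribution.fourier_apply, Lp.toTemperedDistribution_apply] at hd
    have hflip := VectorFourier.integral_fourierIntegral_smul_eq_flip (f := Φ) (g := g)
      (L := innerₗ ℝ) (μ := volume) (ν := volume) Real.continuous_fourierChar
      continuous_inner Φ.integrable h1
    rw [flip_innerₗ] at hflip
    calc ∫ x, φ x • (G : ℝ → ℂ) x = ∫ x, Φ x • (G : ℝ → ℂ) x := by
          refine integral_congr_ae (.of_forall fun x => ?_)
          simp [hΦv]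
      _ = ∫ x, (FourierTransform.fourier Φ) x • (h2.toLp g : ℝ → ℂ) x := hd.symm
      _ = ∫ x, (FourierTransform.fourier Φ) x • g x := by
          refine integral_congr_ae ?_
          filter_upwards [h2.coeFn_toLp] with x hx
          rw [hx]
      _ = ∫ x, Φ x • FourierTransform.fourier g x := hflip
      _ = ∫ x, φ x • FourierTransform.fourier g x := by
          refine integral_congr_ae (.of_forall fun x => ?_)
          simp [hΦv]
  exact (Lp.memLp G).ae_eq hae

/-- The Fourier–Laplace integral of `q` over `[a, b]`. -/
noncomputable def fourierLaplace (q : ℝ → ℂ) (a b : ℝ) (k : ℂ) : ℂ :=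
  ∫ τ in a..b, q τ * exp (I * k * τ)

theorem norm_exp_I_mul_mul_le_one {k : ℂ} (hk : 0 ≤ k.im) {τ : ℝ} (hτ : 0 ≤ τ) :
    ‖exp (I * k * τ)‖ ≤ 1 := by
  rw [norm_exp, Real.exp_le_one_iff]
  simp
  positivity

section FourierLaplace

variable {q : ℝ → ℂ} {a b : ℝ}

theorem differentiable_fourierLaplace (ha : 0 ≤ a) (hab : a ≤ b) (hb : b ≤ 1)
    (hq : IntervalIntegrable q volume a b) : Differentiable ℂ (fourierLaplace q a b) := by
  intro k
  have hm : AEStronglyMeasurable q (volume.restrict (Set.uIoc a b)) :=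
    hq.def'.aestronglyMeasurable
  refine (intervalIntegral.hasDerivAt_integral_of_dominated_loc_of_deriv_le
    (F := fun k τ => q τ * exp (I * k * τ)) (F' := fun k τ => q τ * (exp (I * k * τ) * (I * τ)))
    (bound := fun τ => ‖q τ‖ * Real.exp (‖k‖ + 1)) (Metric.ball_mem_nhds k one_pos)
    (.of_forall fun z => hm.mul (by fun_prop)) (hq.mul_continuousOn (by fun_prop))
    (hm.mul (by fun_prop)) (.of_forall fun τ hτ z hz => ?_) (hq.norm.mul_const _)
    (.of_forall fun τ hτ z hz => ?_)).2.differentiableAt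
  · rw [Set.uIoc_of_le hab] at hτ
    have h0 : |τ| ≤ 1 := by rw [abs_le]; constructor <;> linarith [hτ.1, hτ.2]
    have hz' : ‖z‖ ≤ ‖k‖ + 1 := by
      rw [Metric.mem_ball, dist_eq_norm] at hz
      have := norm_add_le (z - k) k
      rw [sub_add_cancel] at this
      linarith
    rw [norm_mul, norm_mul]
    refine mul_le_mul_of_nonneg_left ?_ (norm_nonneg _)
    have e1 : ‖exp (I * z * τ)‖ ≤ Real.exp (‖k‖ + 1) := by
      refine (norm_exp_le_exp_norm _).trans (Real.exp_le_exp.2 ?_)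
      simp only [norm_mul, norm_I, one_mul, norm_real, Real.norm_eq_abs]
      nlinarith [norm_nonneg z]
    have e2 : ‖I * (τ : ℂ)‖ ≤ 1 := by simpa using h0
    calc _ ≤ Real.exp (‖k‖ + 1) * 1 := mul_le_mul e1 e2 (norm_nonneg _) (Real.exp_pos _).le
      _ = _ := mul_one _
  · have h1 : HasDerivAt (fun z : ℂ => I * z * τ) (I * τ) z := by
      simpa using ((hasDerivAt_id z).const_mul I).mul_const (τ : ℂ)
    exact h1.cexp.const_mul (q τ)

theorem norm_fourierLaplace_le (ha : 0 ≤ a) (hab : a ≤ b)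
    (hq : IntervalIntegrable q volume a b) {k : ℂ} (hk : 0 ≤ k.im) :
    ‖fourierLaplace q a b k‖ ≤ ∫ τ in a..b, ‖q τ‖ := by
  refine intervalIntegral.norm_integral_le_of_norm_le hab (.of_forall fun τ hτ => ?_) hq.norm
  rw [norm_mul]
  exact mul_le_of_le_one_right (norm_nonneg _)
    (norm_exp_I_mul_mul_le_one hk (ha.trans hτ.1.le))

theorem contDiff_polynomial_eval (p : Polynomial ℝ) : ContDiff ℝ 1 fun x => p.eval x := by
  have e : (fun x : ℝ => p.eval x) = fun x => Polynomial.aeval x p := by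
    ext x
    simp [Polynomial.aeval_def, Polynomial.eval₂_eq_eval_map]
  rw [e]
  exact p.contDiff_aeval 1

theorem exists_contDiff_near (hq : ContinuousOn q (Set.Icc a b)) {δ : ℝ} (hδ : 0 < δ) :
    ∃ P : ℝ → ℂ, ContDiff ℝ 1 P ∧ ∀ x ∈ Set.Icc a b, ‖q x - P x‖ ≤ δ := by
  obtain ⟨p, hp⟩ := exists_polynomial_near_of_continuousOn a b (fun x => (q x).re)
    (continuous_re.comp_continuousOn hq) (δ / 2) (by positivity)
  obtain ⟨r, hr⟩ := exists_polynomial_near_of_continuousOn a b (fun x => (q x).im)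
    (continuous_im.comp_continuousOn hq) (δ / 2) (by positivity)
  refine ⟨fun x => ofRealCLM (p.eval x) + ofRealCLM (r.eval x) * I, ?_, fun x hx => ?_⟩
  · have h1 := contDiff_polynomial_eval p
    have h2 := contDiff_polynomial_eval r
    fun_prop
  · refine (norm_le_abs_re_add_abs_im _).trans ?_
    have h1 := hp x hx
    have h2 := hr x hx
    rw [abs_sub_comm] at h1 h2
    simp
    linarith

/-- One integration by parts gains the factor `1/k`. The bound is uniform in the closed half plane
because `|e^{ikτ}| ≤ 1` whenever `τ ≥ 0`. -/
theorem exists_norm_fourierLaplace_le_div (ha : 0 ≤ a) (hab : a ≤ b) {P : ℝ → ℂ}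
    (hP : ContDiff ℝ 1 P) : ∃ C, ∀ k : ℂ, k ≠ 0 → 0 ≤ k.im →
      ‖fourierLaplace P a b k‖ ≤ C * ‖k⁻¹‖ := by
  refine ⟨‖P b‖ + ‖P a‖ + ∫ τ in a..b, ‖deriv P τ‖, fun k hk0 hk => ?_⟩
  have hP' : Continuous (deriv P) := hP.continuous_deriv le_rfl
  have hIk : I * k ≠ 0 := mul_ne_zero I_ne_zero hk0
  have hv : ∀ x ∈ Set.uIcc a b, HasDerivAt (fun τ : ℝ => exp (I * k * τ) / (I * k))
      (exp (I * k * x)) x := fun x _ => by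
    have h1 : HasDerivAt (fun z : ℂ => I * k * z) (I * k) x := by
      simpa using (hasDerivAt_id (x : ℂ)).const_mul (I * k)
    have := (h1.cexp.div_const (I * k)).comp_ofReal
    rwa [mul_div_cancel_right₀ _ hIk] at this
  rw [fourierLaplace, intervalIntegral.integral_mul_deriv_eq_deriv_mul
    (fun x _ => (hP.differentiable one_ne_zero x).hasDerivAt) hv
    (hP'.intervalIntegrable _ _) ((by fun_prop : Continuous _).intervalIntegrable _ _)]
  have hle : ∀ τ : ℝ, 0 ≤ τ → ‖exp (I * k * τ) / (I * k)‖ ≤ ‖k⁻¹‖ := fun τ hτ => by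
    rw [norm_div, norm_mul, norm_I, one_mul, norm_inv, div_eq_mul_inv]
    exact mul_le_of_le_one_left (by positivity) (norm_exp_I_mul_mul_le_one hk hτ)
  rw [add_mul, add_mul]
  refine (norm_sub_le _ _).trans (add_le_add ((norm_sub_le _ _).trans (add_le_add ?_ ?_)) ?_)
  · rw [norm_mul]
    exact mul_le_mul_of_nonneg_left (hle b (ha.trans hab)) (norm_nonneg _)
  · rw [norm_mul]
    exact mul_le_mul_of_nonneg_left (hle a ha) (norm_nonneg _)
  · rw [← intervalIntegral.integral_mul_const]
    refine intervalIntegral.norm_integral_le_of_norm_le hab (.of_forall fun τ hτ => ?_)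
      ((by fun_prop : Continuous fun τ => ‖deriv P τ‖ * ‖k⁻¹‖).intervalIntegrable _ _)
    rw [norm_mul]
    exact mul_le_mul_of_nonneg_left (hle τ (ha.trans hτ.1.le)) (norm_nonneg _)

/-- The Riemann–Lebesgue lemma, uniformly in the closed upper half plane. -/
theorem tendsto_fourierLaplace (ha : 0 ≤ a) (hab : a ≤ b) (hb : b ≤ 1)
    (hq : ContinuousOn q (Set.Icc a b)) :
    Tendsto (fourierLaplace q a b) (Bornology.cobounded ℂ ⊓ 𝓟 {z | 0 ≤ z.im}) (𝓝 0) := by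
  rw [Metric.tendsto_nhds]
  intro δ hδ
  obtain ⟨P, hP, hPq⟩ := exists_contDiff_near hq (half_pos hδ)
  obtain ⟨C, hC⟩ := exists_norm_fourierLaplace_le_div ha hab hP
  have h0 : Tendsto (fun k : ℂ => C * ‖k⁻¹‖) (Bornology.cobounded ℂ) (𝓝 0) := by
    simpa using (tendsto_inv₀_cobounded (α := ℂ)).norm.const_mul C
  have h1 := h0.eventually (eventually_lt_nhds (half_pos hδ))
  rw [eventually_inf_principal]
  filter_upwards [h1, Bornology.eventually_ne_cobounded 0] with k hk hk0 hkim
  rw [dist_zero_right]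
  have hqi : IntervalIntegrable q volume a b :=
    ContinuousOn.intervalIntegrable_of_Icc hab hq
  have hPi : IntervalIntegrable P volume a b := hP.continuous.intervalIntegrable _ _
  have e : fourierLaplace q a b k =
      fourierLaplace (fun τ => q τ - P τ) a b k + fourierLaplace P a b k := by
    simp only [fourierLaplace, sub_mul]
    rw [intervalIntegral.integral_sub (hqi.mul_continuousOn (by fun_prop))
      (hPi.mul_continuousOn (by fun_prop)), sub_add_cancel]
  have h2 : ‖fourierLaplace (fun τ => q τ - P τ) a b k‖ ≤ δ / 2 * |b - a| := by
    refine intervalIntegral.norm_integral_le_of_norm_le_const fun τ hτ => ?_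
    rw [Set.uIoc_of_le hab] at hτ
    rw [norm_mul]
    exact (mul_le_of_le_one_right (norm_nonneg _)
      (norm_exp_I_mul_mul_le_one hkim (ha.trans hτ.1.le))).trans (hPq τ ⟨hτ.1.le, hτ.2⟩)
  have h3 : |b - a| ≤ 1 := by rw [abs_of_nonneg (by linarith)]; linarith
  rw [e]
  refine (norm_add_le _ _).trans_lt ?_
  have := hC k hk0 hkim
  nlinarith

/-- For real `t` the integral is the Fourier transform of `q` cut off to the interval, evaluated at
`-t/(2π)`; Plancherel and a rescaling finish. -/
theorem memLp_fourierLaplace (hab : a ≤ b) (hq : ContinuousOn q (Set.Icc a b)) :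
    MemLp (fun t : ℝ => fourierLaplace q a b t) 2 := by
  set g : ℝ → ℂ := (Set.Ioc a b).indicator q with hg
  have hq' : ContinuousOn q (Set.Ioc a b) := hq.mono Set.Ioc_subset_Icc_self
  obtain ⟨C, hC⟩ := isCompact_Icc.exists_bound_of_continuousOn hq
  have hfin : volume (Set.Ioc a b) ≠ ⊤ := by simp
  have hmeas := hq'.aestronglyMeasurable (μ := volume) measurableSet_Ioc
  have hbound : ∀ᵐ x ∂volume.restrict (Set.Ioc a b), ‖q x‖ ≤ C :=
    (ae_restrict_iff' measurableSet_Ioc).2 (.of_forall fun x hx => hC x ⟨hx.1.le, hx.2⟩)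
  have : IsFiniteMeasure (volume.restrict (Set.Ioc a b)) := ⟨by simp⟩
  have hp : ∀ p, MemLp g p := fun p => by
    rw [hg, memLp_indicator_iff_restrict measurableSet_Ioc]
    exact MemLp.of_bound hmeas C hbound
  have hF := memLp_fourier (memLp_one_iff_integrable.1 (hp 1)) (hp 2)
  have e : ∀ t : ℝ, fourierLaplace q a b t =
      FourierTransform.fourier g (t * (-(2 * Real.pi))⁻¹) := fun t => by
    rw [Real.fourier_real_eq_integral_exp_smul, fourierLaplace,
      intervalIntegral.integral_of_le hab, ← integral_indicator measurableSet_Ioc]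
    congr 1
    ext τ
    by_cases hτ : τ ∈ Set.Ioc a b
    · simp only [hg, Set.indicator_of_mem hτ, smul_eq_mul]
      rw [mul_comm]
      congr 2
      have : (Real.pi : ℂ) ≠ 0 := by exact_mod_cast Real.pi_ne_zero
      push_cast
      field_simp
    · simp [hg, Set.indicator_of_notMem hτ]
  simp_rw [e]
  have hmF : AEStronglyMeasurable
      (fun t : ℝ => FourierTransform.fourier g (t * (-(2 * Real.pi))⁻¹)) volume := by
    have hcont : Continuous (FourierTransform.fourier g : ℝ → ℂ) :=
      VectorFourier.fourierIntegral_continuous Real.continuous_fourierChar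
        (innerSL ℝ).continuous₂ (memLp_one_iff_integrable.1 (hp 1))
    exact (hcont.comp (by fun_prop)).aestronglyMeasurable
  rw [memLp_two_iff_integrable_sq_norm hmF]
  exact ((memLp_two_iff_integrable_sq_norm hF.aestronglyMeasurable).1 hF).comp_mul_right'
    (by simp [Real.pi_ne_zero])

theorem isUpperBoundary_fourierLaplace (ha : 0 ≤ a) (hab : a ≤ b) (hb : b ≤ 1)
    (hq : ContinuousOn q (Set.Icc a b)) (c : ℂ) :
    IsUpperBoundary fun k => c * fourierLaplace q a b k where
  cont := (((differentiable_fourierLaplace ha hab hb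
    (hq.intervalIntegrable_of_Icc hab)).const_mul c).continuous).continuousOn
  holo := ((differentiable_fourierLaplace ha hab hb
    (hq.intervalIntegrable_of_Icc hab)).const_mul c).differentiableOn
  decay := by simpa using (tendsto_fourierLaplace ha hab hb hq).const_mul c
  memLp := (memLp_fourierLaplace hab hq).const_mul c

end FourierLaplace

/-! ### The mollifier and the cut-off `μ_ε`. -/

theorem psi_eq (t : ℝ) : psi t =
    (∫ u in (-1 : ℝ)..1, Real.exp (1 / (u ^ 2 - 1)))⁻¹ * expNegInvGlue (1 - t ^ 2) := by
  unfold psi expNegInvGlue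
  by_cases h : t ^ 2 < 1
  · rw [if_pos h, if_neg (by linarith), one_div, ← neg_sub, ← inv_neg, neg_sub]
  · rw [if_neg h, if_pos (by linarith), mul_zero]

theorem psi_neg (t : ℝ) : psi (-t) = psi t := by
  simp [psi]

theorem psi_eq_zero {t : ℝ} (ht : 1 ≤ |t|) : psi t = 0 := by
  rw [psi, if_neg]
  rw [not_lt, ← sq_abs]
  exact one_le_pow₀ ht

theorem exists_lipschitzWith_psi : ∃ K, LipschitzWith K psi := by
  have hc : HasCompactSupport psi := by
    refine HasCompactSupport.intro (isCompact_Icc (a := -1) (b := 1)) fun t ht => psi_eq_zero ?_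
    by_contra h
    rw [not_le, abs_lt] at h
    exact ht ⟨h.1.le, h.2.le⟩
  have hd : ContDiff ℝ 1 psi := by
    rw [funext psi_eq]
    exact contDiff_const.mul (expNegInvGlue.contDiff.comp (by fun_prop))
  exact hd.lipschitzWith_of_hasCompactSupport hc one_ne_zero

theorem nu_nonneg (ε x : ℝ) : 0 ≤ nu ε x := Set.indicator_nonneg (fun _ _ => zero_le_one) x

theorem nu_one_sub (ε x : ℝ) : nu ε (1 - x) = nu ε x := by
  unfold nu
  simp only [Set.indicator_apply]
  congr 1
  simp only [Set.mem_union, Set.mem_Ioo, eq_iff_iff]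
  grind

theorem integrable_nu (ε : ℝ) : Integrable (nu ε) := by
  refine (integrable_indicator_iff (measurableSet_Ioo.union measurableSet_Ioo)).2 ?_
  refine integrableOn_const ?_
  exact ((measure_union_le _ _).trans_lt (by simp)).ne

theorem mu_eq (ε x : ℝ) : mu ε x = 1 / ε * ∫ t : ℝ, psi ((x - t) / ε) * nu ε t := by
  rw [mu, ← integral_sub_left_eq_self (fun t : ℝ => psi (t / ε) * nu ε (x - t)) volume x]
  simp

theorem mu_one_sub (ε x : ℝ) : mu ε (1 - x) = mu ε x := by
  rw [mu, mu, ← integral_neg_eq_self]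
  congr 2
  ext t
  rw [neg_div, psi_neg, ← nu_one_sub]
  congr 2
  ring

/-- The Lipschitz bound is inherited from `psi`. Continuity alone would not suffice later: a linear
rate is used to absorb the logarithmic growth of `ln ζ` at an endpoint. -/
theorem exists_abs_mu_sub_le {ε : ℝ} (hε : 0 < ε) : ∃ C, ∀ x y, |mu ε x - mu ε y| ≤ C * |x - y| := by
  obtain ⟨K, hK⟩ := exists_lipschitzWith_psi
  have hi : ∀ x, Integrable fun t : ℝ => psi ((x - t) / ε) * nu ε t := fun x => by
    have hc : Continuous fun t : ℝ => psi ((x - t) / ε) := hK.continuous.comp (by fun_prop)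
    obtain ⟨M, hM⟩ := (isCompact_Icc (a := (-1 : ℝ)) (b := 1)).exists_bound_of_continuousOn
      hK.continuous.continuousOn
    refine (integrable_nu ε).bdd_mul (c := max M 0) hc.aestronglyMeasurable
      (.of_forall fun t => ?_)
    by_cases h : 1 ≤ |(x - t) / ε|
    · rw [psi_eq_zero h, norm_zero]
      exact le_max_right _ _
    · rw [not_le, abs_lt] at h
      exact (hM _ ⟨h.1.le, h.2.le⟩).trans (le_max_left _ _)
  refine ⟨1 / ε * (K / ε * ∫ t, nu ε t), fun x y => ?_⟩
  rw [mu_eq, mu_eq, ← mul_sub, ← integral_sub (hi x) (hi y), abs_mul, abs_of_pos (by positivity),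
    mul_assoc]
  refine mul_le_mul_of_nonneg_left ?_ (by positivity)
  rw [mul_right_comm, ← integral_const_mul, ← Real.norm_eq_abs]
  refine norm_integral_le_of_norm_le ((integrable_nu ε).const_mul _) (.of_forall fun t => ?_)
  rw [← sub_mul, norm_mul, Real.norm_of_nonneg (nu_nonneg ε t)]
  refine mul_le_mul_of_nonneg_right ?_ (nu_nonneg ε t)
  have := hK.dist_le_mul ((x - t) / ε) ((y - t) / ε)
  rw [dist_eq_norm, dist_eq_norm] at this
  refine this.trans_eq ?_
  rw [← sub_div, sub_sub_sub_cancel_right, norm_div, Real.norm_of_nonneg hε.le, Real.norm_eq_abs]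
  ring

theorem continuous_mu {ε : ℝ} (hε : 0 < ε) : Continuous (mu ε) := by
  obtain ⟨C, hC⟩ := exists_abs_mu_sub_le hε
  exact (LipschitzWith.of_dist_le_mul (K := C.toNNReal) fun x y => by
    rw [Real.dist_eq, Real.dist_eq]
    exact (hC x y).trans (mul_le_mul_of_nonneg_right (Real.le_coe_toNNReal C)
      (abs_nonneg _))).continuous

/-- The mollifier centred at `ε` only sees points below `2ε`, where `ν_ε` is zero. -/
theorem mu_self {ε : ℝ} (hε : 0 < ε) : mu ε ε = 0 := by
  rw [mu_eq, integral_eq_zero_of_ae, mul_zero]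
  refine .of_forall fun t => ?_
  simp only [Pi.zero_apply, mul_eq_zero]
  by_cases h : 1 ≤ |(ε - t) / ε|
  · exact .inl (psi_eq_zero h)
  · right
    rw [not_le, abs_lt, lt_div_iff₀ hε, div_lt_iff₀ hε] at h
    refine Set.indicator_of_notMem ?_ _
    rintro (h' | h') <;> have := h'.1 <;> linarith

/-! ### The tail of the prime zeta series. -/

/-- Two powers of `p` are kept for summability over primes; the remaining `p^{-(Re w - 2)}` is
bounded by its value at `p = 2`, which supplies geometric decay in `j`. -/
theorem norm_one_div_prime_cpow_le {w : ℂ} (hw : 2 ≤ w.re) (p : Nat.Primes) :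
    ‖1 / ((p : ℕ) : ℂ) ^ w‖ ≤ (2 : ℝ) ^ (-(w.re - 2)) * (1 / ((p : ℕ) : ℝ) ^ 2) := by
  have hp : (2 : ℝ) ≤ (p : ℕ) := by exact_mod_cast p.2.two_le
  have hp0 : (0 : ℝ) < (p : ℕ) := by linarith
  rw [norm_div, norm_one, norm_natCast_cpow_of_pos p.2.pos, Real.rpow_neg two_pos.le,
    ← one_div, one_div_mul_one_div]
  refine one_div_le_one_div_of_le (by positivity) ?_
  have : ((p : ℕ) : ℝ) ^ w.re = ((p : ℕ) : ℝ) ^ (w.re - 2) * ((p : ℕ) : ℝ) ^ 2 := by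
    rw [← Real.rpow_natCast, ← Real.rpow_add hp0]
    norm_num
  rw [this]
  refine mul_le_mul_of_nonneg_right ?_ (by positivity)
  exact Real.rpow_le_rpow two_pos.le hp (by linarith)

theorem summable_one_div_prime_sq : Summable fun p : Nat.Primes => 1 / ((p : ℕ) : ℝ) ^ 2 :=
  (Real.summable_one_div_nat_pow.2 one_lt_two).comp_injective Subtype.val_injective

theorem norm_primeZeta_le {w : ℂ} (hw : 2 ≤ w.re) :
    ‖primeZeta w‖ ≤ (2 : ℝ) ^ (-(w.re - 2)) * ∑' p : Nat.Primes, 1 / ((p : ℕ) : ℝ) ^ 2 :=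
  tsum_of_norm_bounded (summable_one_div_prime_sq.hasSum.mul_left _)
    (norm_one_div_prime_cpow_le hw)

theorem continuousOn_primeZeta : ContinuousOn primeZeta {w | 2 ≤ w.re} := by
  refine continuousOn_tsum (fun p => ?_) summable_one_div_prime_sq fun p w hw => ?_
  · have hp : ((p : ℕ) : ℂ) ≠ 0 := by exact_mod_cast p.2.ne_zero
    exact (continuous_const.div (continuous_id.const_cpow (.inl hp)) fun w => by simp [cpow_def, hp]).continuousOn
  · refine (norm_one_div_prime_cpow_le hw p).trans (mul_le_of_le_one_left (by positivity) ?_)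
    exact Real.rpow_le_one_of_one_le_of_nonpos one_le_two (by simpa using hw)

theorem continuousOn_primeTail {m : ℕ} (hm : 0 < m) {ε : ℝ} (hε : 2 / (m : ℝ) < ε) :
    ContinuousOn (primeTail m) {s | ε ≤ s.re} := by
  have hm' : (0 : ℝ) < m := by exact_mod_cast hm
  have hε0 : 0 < ε := lt_trans (by positivity) hε
  rw [div_lt_iff₀ hm'] at hε
  -- The hypothesis `m ε > 2` enters here; the surplus `j ε` gives the geometric ratio `2^{-ε}`.
  have key : ∀ (j : ℕ) (s : ℂ), ε ≤ s.re → 2 + j * ε ≤ (((m + j : ℕ) : ℂ) * s).re := by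
    intro j s hs
    rw [mul_re, natCast_re, natCast_im, zero_mul, sub_zero, Nat.cast_add]
    have : (m + j : ℝ) * ε ≤ (m + j : ℝ) * s.re := by gcongr
    nlinarith
  have h2 : ∀ (j : ℕ) (s : ℂ), ε ≤ s.re → 2 ≤ (((m + j : ℕ) : ℂ) * s).re := fun j s hs =>
    le_trans (by have : 0 ≤ j * ε := by positivity
                 linarith) (key j s hs)
  have hr : (2 : ℝ) ^ (-ε) < 1 := Real.rpow_lt_one_of_one_lt_of_neg one_lt_two (by linarith)
  refine continuousOn_tsum (u := fun j : ℕ => ((2 : ℝ) ^ (-ε)) ^ j *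
    ∑' p : Nat.Primes, 1 / ((p : ℕ) : ℝ) ^ 2) (fun j => ?_) ?_ fun j s hs => ?_
  · exact (continuousOn_primeZeta.comp (continuous_const.mul continuous_id).continuousOn
      fun s hs => h2 j s hs).div_const _
  · exact (summable_geometric_of_lt_one (by positivity) hr).mul_right _
  · have hj : 1 ≤ ‖((m + j : ℕ) : ℂ)‖ := by
      rw [norm_natCast]
      exact_mod_cast (by omega : 1 ≤ m + j)
    rw [norm_div]
    refine (div_le_self (norm_nonneg _) hj).trans ((norm_primeZeta_le (h2 j s hs)).trans ?_)
    refine mul_le_mul_of_nonneg_right ?_ (tsum_nonneg fun p => by positivity)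
    rw [← Real.rpow_mul_natCast two_pos.le]
    refine Real.rpow_le_rpow_of_exponent_le one_le_two ?_
    have := key j s hs
    linarith

/-! ### Branches of the logarithm. -/

/-- Uniqueness of lifts through the covering map `exp`. -/
theorem eqOn_of_exp_eqOn {X : Type*} [TopologicalSpace X] {S : Set X} (hS : IsPreconnected S)
    {f g : X → ℂ} (hf : ContinuousOn f S) (hg : ContinuousOn g S)
    (he : ∀ x ∈ S, exp (f x) = exp (g x)) {x₀ : X} (hx₀ : x₀ ∈ S) (h₀ : f x₀ = g x₀) :
    S.EqOn f g :=
  isCoveringMap_exp.eqOn_of_comp_eqOn hS hf hg (fun x hx => Subtype.ext (he x hx)) hx₀ h₀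

/-- A branch of the logarithm of an analytic function grows at most logarithmically at a zero. -/
theorem tendsto_mul_log_branch {Z : ℂ → ℂ} (hZ : AnalyticAt ℂ Z 0) {η : ℝ} (hη : 0 < η)
    {φ : ℝ → ℂ} (hφ : ContinuousOn φ (Set.Ioo 0 η))
    (he : ∀ δ ∈ Set.Ioo 0 η, exp (φ δ) = Z δ) :
    Tendsto (fun δ : ℝ => δ * φ δ) (𝓝[>] 0) (𝓝 0) := by
  have hcoe : Tendsto (fun δ : ℝ => (δ : ℂ)) (𝓝[>] 0) (𝓝 0) := by
    have : Tendsto (fun δ : ℝ => (δ : ℂ)) (𝓝 0) (𝓝 ((0 : ℝ) : ℂ)) := continuous_ofReal.tendsto 0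
    rw [ofReal_zero] at this
    exact this.mono_left nhdsWithin_le_nhds
  have hIoo : Set.Ioo 0 η ∈ 𝓝[>] (0 : ℝ) := Ioo_mem_nhdsGT hη
  -- `Z` cannot vanish identically near `0`, being an exponential on `(0, η)`; so it is `w ^ N`
  -- times a nonvanishing analytic factor.
  obtain ⟨N, g, hg, hg0, hZg⟩ := hZ.exists_eventuallyEq_pow_smul_nonzero_iff.2 fun h => by
    obtain ⟨δ, h1, h2⟩ := ((hcoe.eventually h).and hIoo).exists
    rw [← he δ h2] at h1
    exact exp_ne_zero _ h1
  have hslit : ∀ᶠ w in 𝓝 (0 : ℂ), g w / g 0 ∈ slitPlane := by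
    have : Tendsto (fun w => g w / g 0) (𝓝 0) (𝓝 1) := by
      simpa [hg0] using hg.continuousAt.tendsto.div_const (g 0)
    exact this.eventually (isOpen_slitPlane.mem_nhds one_mem_slitPlane)
  have hev := hcoe.eventually (hZg.and (hslit.and hg.eventually_continuousAt))
  obtain ⟨r, hr, hr'⟩ := (mem_nhdsGT_iff_exists_Ioo_subset' one_pos).1 (hev.and hIoo)
  have hr0 : 0 < r := hr
  -- An explicit logarithm of `δ ^ N g(δ)`. Normalizing by `g 0` keeps the principal logarithm near
  -- `1`, away from its cut; `φ` can then differ from `ψ` only by a constant.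
  set ψ : ℝ → ℂ := fun δ => N * (Real.log δ : ℂ) + (log (g δ / g 0) + log (g 0)) with hψ
  have hgc : Tendsto (fun δ : ℝ => log (g δ / g 0)) (𝓝[>] 0) (𝓝 0) := by
    have h1 : Tendsto (fun w => g w / g 0) (𝓝 0) (𝓝 1) := by
      simpa [hg0] using hg.continuousAt.tendsto.div_const (g 0)
    simpa using (h1.comp hcoe).clog one_mem_slitPlane
  have hψc : ContinuousOn ψ (Set.Ioo 0 r) := by
    intro δ hδ
    obtain ⟨⟨-, h1, h2⟩, -⟩ := hr' hδ
    have hδ0 : δ ≠ 0 := hδ.1.ne'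
    have c1 : ContinuousAt (fun δ : ℝ => g δ) δ :=
      ContinuousAt.comp (f := fun δ : ℝ => (δ : ℂ)) h2 continuous_ofReal.continuousAt
    have c2 : ContinuousAt (fun δ : ℝ => (Real.log δ : ℂ)) δ :=
      continuous_ofReal.continuousAt.comp (Real.continuousAt_log hδ0)
    exact ((continuousAt_const.mul c2).add
      (((c1.div_const _).clog h1).add continuousAt_const)).continuousWithinAt
  have hψe : ∀ δ ∈ Set.Ioo 0 r, exp (ψ δ) = Z δ := by
    intro δ hδ
    obtain ⟨⟨h0, h1, -⟩, -⟩ := hr' hδ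
    rw [hψ, exp_add, exp_add, exp_log (slitPlane_ne_zero h1), exp_log hg0, exp_nat_mul,
      ← ofReal_exp, Real.exp_log hδ.1, h0, sub_zero, smul_eq_mul]
    field_simp
  have hδ₀ : r / 2 ∈ Set.Ioo 0 r := ⟨by linarith, by linarith⟩
  set c := φ (r / 2) - ψ (r / 2) with hc
  have hce : exp c = 1 := by
    rw [hc, exp_sub, he _ (hr' hδ₀).2, hψe _ hδ₀, div_self]
    rw [← hψe _ hδ₀]
    exact exp_ne_zero _
  have heq : (Set.Ioo 0 r).EqOn φ fun δ => ψ δ + c := by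
    refine eqOn_of_exp_eqOn isPreconnected_Ioo (hφ.mono fun δ hδ => (hr' hδ).2)
      (hψc.add continuousOn_const) (fun δ hδ => ?_) hδ₀ (by simp [hc])
    rw [exp_add, hce, mul_one, hψe δ hδ, he δ (hr' hδ).2]
  have hlog : Tendsto (fun δ : ℝ => (N : ℂ) * ((δ * Real.log δ : ℝ) : ℂ)) (𝓝[>] 0) (𝓝 0) := by
    have h0 : Tendsto (fun δ : ℝ => ((δ * Real.log δ : ℝ) : ℂ)) (𝓝 0) (𝓝 0) := by
      simpa [Function.comp_def] using (continuous_ofReal.comp Real.continuous_mul_log).tendsto 0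
    have := h0.mono_left (nhdsWithin_le_nhds (s := Set.Ioi 0))
    simpa using this.const_mul (N : ℂ)
  have hlim := hlog.add (hcoe.mul ((hgc.add_const (log (g 0))).add_const c))
  rw [zero_mul, add_zero] at hlim
  refine hlim.congr' ?_
  filter_upwards [Ioo_mem_nhdsGT hr0] with δ hδ
  rw [heq hδ]
  simp only [hψ]
  push_cast
  ring

/-! ### The logarithm of Gamma and the functional equation. -/

theorem differentiableOn_Gamma_re_pos : DifferentiableOn ℂ Gamma {z | 0 < z.re} := fun z hz =>
  (differentiableAt_Gamma z fun m h => by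
    have hz' : 0 < z.re := hz
    rw [h, neg_re, natCast_re] at hz'
    have : (0 : ℝ) ≤ m := m.cast_nonneg
    linarith).differentiableWithinAt

theorem isOpen_re_pos : IsOpen {z : ℂ | 0 < z.re} := isOpen_lt continuous_const continuous_re

theorem continuousOn_digamma : ContinuousOn digamma {z | 0 < z.re} :=
  (differentiableOn_Gamma_re_pos.deriv isOpen_re_pos).continuousOn.div
    differentiableOn_Gamma_re_pos.continuousOn fun _ hz => Gamma_ne_zero_of_re_pos hz

theorem re_segment_pos {z : ℂ} (hz : 0 < z.re) {t : ℝ} (ht : t ∈ Set.Icc (0 : ℝ) 1) :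
    0 < (1 + (t : ℂ) * (z - 1)).re := by
  simp
  rcases eq_or_lt_of_le ht.1 with h | h
  · simp [← h]
  · nlinarith [ht.2]

/-- Along the segment from `1` to `z`, the product of `Γ` with the exponential of minus the
accumulated integral of its logarithmic derivative has derivative zero, and it starts at `Γ(1) = 1`.
-/
theorem exp_logGamma {z : ℂ} (hz : 0 < z.re) : exp (logGamma z) = Gamma z := by
  set d : ℝ → ℂ := fun t => (z - 1) * digamma (1 + (t : ℂ) * (z - 1)) with hd
  set U : Set ℝ := {t | 0 < (1 + (t : ℂ) * (z - 1)).re} with hU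
  have hUo : IsOpen U := isOpen_lt continuous_const (by fun_prop)
  have hdc : ContinuousOn d U := continuousOn_const.mul
    (continuousOn_digamma.comp (by fun_prop) fun t ht => ht)
  have hsub : Set.Icc 0 1 ⊆ U := fun t ht => re_segment_pos hz ht
  have hder : ∀ t ∈ Set.Icc (0 : ℝ) 1, HasDerivAt (fun u : ℝ =>
      Gamma (1 + (u : ℂ) * (z - 1)) * exp (-∫ x in (0 : ℝ)..u, d x)) 0 t := by
    intro t ht
    have htU := hsub ht
    have h1 : HasDerivAt (fun u : ℝ => ∫ x in (0 : ℝ)..u, d x) (d t) t := by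
      refine intervalIntegral.integral_hasDerivAt_right ?_
        (hdc.stronglyMeasurableAtFilter hUo t htU) (hdc.continuousAt (hUo.mem_nhds htU))
      refine (hdc.mono fun x hx => hsub ?_).intervalIntegrable
      rw [Set.uIcc_of_le ht.1] at hx
      exact ⟨hx.1, hx.2.trans ht.2⟩
    have h2 : HasDerivAt (fun u : ℝ => 1 + (u : ℂ) * (z - 1)) (z - 1) t := by
      simpa using ((hasDerivAt_id t).ofReal_comp.mul_const (z - 1)).const_add 1
    have h3 : HasDerivAt Gamma (deriv Gamma (1 + (t : ℂ) * (z - 1))) (1 + (t : ℂ) * (z - 1)) :=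
      (differentiableOn_Gamma_re_pos.differentiableAt (isOpen_re_pos.mem_nhds htU)).hasDerivAt
    have h4 := (h3.comp t h2).mul h1.neg.cexp
    refine h4.congr_deriv ?_
    have h5 : Gamma (1 + (t : ℂ) * (z - 1)) ≠ 0 := Gamma_ne_zero_of_re_pos htU
    simp only [hd, digamma_def, logDeriv_apply, Function.comp]
    field_simp
    ring
  have hconst := constant_of_has_deriv_right_zero
    (fun t ht => (hder t ht).continuousAt.continuousWithinAt)
    (fun t ht => (hder t ⟨ht.1, ht.2.le⟩).hasDerivWithinAt) 1 ⟨zero_le_one, le_rfl⟩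
  simp only [ofReal_one, one_mul, ofReal_zero, zero_mul, add_zero, Gamma_one,
    intervalIntegral.integral_same, neg_zero, exp_zero, add_sub_cancel] at hconst
  rw [exp_neg, mul_inv_eq_one₀ (exp_ne_zero _)] at hconst
  exact hconst.symm

theorem continuousOn_logGamma : ContinuousOn logGamma {z | 0 < z.re} := by
  -- Clamping `t` to `[0, 1]` leaves the integral unchanged and makes the integrand jointly
  -- continuous for all real `t`.
  have e : ∀ z, logGamma z = ∫ t in (0 : ℝ)..1, (z - 1) *
      digamma (1 + ((Set.projIcc (0 : ℝ) 1 zero_le_one t : ℝ) : ℂ) * (z - 1)) := fun z => by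
    refine intervalIntegral.integral_congr fun t ht => ?_
    rw [Set.uIcc_of_le zero_le_one] at ht
    simp only [Set.projIcc_of_mem zero_le_one ht]
  rw [funext e, continuousOn_iff_continuous_domRestrict]
  refine intervalIntegral.continuous_parametric_intervalIntegral_of_continuous' ?_ _ _
  refine Continuous.mul (by fun_prop) (continuousOn_digamma.comp_continuous (by fun_prop) ?_)
  rintro ⟨⟨z, hz⟩, t⟩
  exact re_segment_pos hz (Set.projIcc (0 : ℝ) 1 zero_le_one t).2

theorem continuousOn_F : ContinuousOn F {s | 0 < s.re ∧ s.re < 1} := by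
  have h1 : ContinuousOn (fun s : ℂ => logGamma (s / 2)) {s | 0 < s.re ∧ s.re < 1} :=
    continuousOn_logGamma.comp (by fun_prop) fun s hs => by
      have := hs.1
      simpa using this
  have h2 : ContinuousOn (fun s : ℂ => logGamma ((1 - s) / 2)) {s | 0 < s.re ∧ s.re < 1} :=
    continuousOn_logGamma.comp (by fun_prop) fun s hs => by
      have := hs.2
      simpa using this
  unfold F
  fun_prop

/-- Riemann's functional equation in the critical strip, in terms of `F`. -/
theorem riemannZeta_eq_mul_exp_F {s : ℂ} (h0 : 0 < s.re) (h1 : s.re < 1) :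
    riemannZeta s = riemannZeta (1 - s) * exp (F s) := by
  have hs : s ≠ 0 := fun h => by simp [h] at h0
  have hs' : 1 - s ≠ 0 := fun h => by
    rw [sub_eq_zero] at h
    simp [← h] at h1
  have p1 : 0 < (1 - s).re := by simpa using h1
  have q1 : 0 < (s / 2).re := by simpa using h0
  have q2 : 0 < ((1 - s) / 2).re := by simpa using h1
  rw [riemannZeta_def_of_ne_zero hs, riemannZeta_def_of_ne_zero hs',
    completedRiemannZeta_one_sub, Gammaℝ_def, Gammaℝ_def]
  have hpi : ∀ w : ℂ, (Real.pi : ℂ) ^ w = exp (w * (Real.log Real.pi : ℂ)) := fun w => by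
    rw [cpow_def_of_ne_zero (by exact_mod_cast Real.pi_ne_zero), ofReal_log Real.pi_pos.le,
      mul_comm]
  have g1 := Gamma_ne_zero_of_re_pos q1
  have g2 := Gamma_ne_zero_of_re_pos q2
  rw [F, exp_add, exp_sub, exp_sub, exp_logGamma q1, exp_logGamma q2, hpi, hpi, neg_div, neg_div,
    neg_mul, neg_mul, exp_neg, exp_neg]
  field_simp

/-! ### Continuity of `Q_ε` up to the endpoints. -/

theorem tendsto_mul_mu {ε : ℝ} (hε : 0 < ε) {f : ℝ → ℂ} {c : ℝ} (hc : mu ε c = 0)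
    {l : Filter ℝ} (h : Tendsto (fun τ : ℝ => ((τ - c : ℝ) : ℂ) * f τ) l (𝓝 0)) :
    Tendsto (fun τ => f τ * (mu ε τ : ℂ)) l (𝓝 0) := by
  obtain ⟨C, hC⟩ := exists_abs_mu_sub_le hε
  have h' := h.norm.const_mul C
  rw [norm_zero, mul_zero] at h'
  refine squeeze_zero_norm (fun τ => ?_) h'
  have := hC τ c
  rw [hc, sub_zero] at this
  rw [norm_mul, norm_mul, norm_real, norm_real, Real.norm_eq_abs, Real.norm_eq_abs]
  nlinarith [norm_nonneg (f τ)]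

theorem analyticAt_riemannZeta_affine {b : ℂ} (hb : b ≠ 1) (u : ℂ) :
    AnalyticAt ℂ (fun w => riemannZeta (b + u * w)) 0 := by
  refine AnalyticAt.comp (g := riemannZeta) (f := fun w => b + u * w) ?_ (by fun_prop)
  exact analyticOn_riemannZeta _ (by simpa using hb)

section Segment

variable {L : ℂ → ℂ} {m : ℕ} {ε β : ℝ}

theorem mem_hseg {τ : ℝ} (hτ : τ ∈ Set.Ioo ε (1 - ε)) : (τ : ℂ) + β * I ∈ hseg ε β := by
  simpa [hseg] using hτ

/-- Only the endpoints need an argument, as `L` is controlled just on the open segment. The value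
there is `0` whatever `L` is, since `μ_ε` vanishes, and the limit is `0` because `δ ln ζ → 0` at
distance `δ` from the endpoint. -/
theorem continuousOn_log_mul_mu (hε : 0 < ε) (hε' : ε < 1 / 2)
    (hc : ContinuousOn L (hseg ε β)) (he : ∀ z ∈ hseg ε β, exp (L z) = riemannZeta z) :
    ContinuousOn (fun τ : ℝ => L (τ + β * I) * (mu ε τ : ℂ)) (Set.Icc ε (1 - ε)) := by
  have hlt : ε < 1 - ε := by linarith
  have hmu : Continuous fun τ : ℝ => (mu ε τ : ℂ) := continuous_ofReal.comp (continuous_mu hε)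
  have hLc : ContinuousOn (fun τ : ℝ => L (τ + β * I)) (Set.Ioo ε (1 - ε)) :=
    hc.comp (by fun_prop) fun τ hτ => mem_hseg hτ
  have hmu1 : mu ε (1 - ε) = 0 := by rw [mu_one_sub, mu_self hε]
  intro τ hτ
  rcases eq_or_lt_of_le hτ.1 with rfl | h1
  · rw [continuousWithinAt_Icc_iff_Ici hlt, ← continuousWithinAt_Ioi_iff_Ici, ContinuousWithinAt,
      mu_self hε, ofReal_zero, mul_zero]
    refine tendsto_mul_mu hε (mu_self hε) ?_
    have key := tendsto_mul_log_branch (η := 1 - 2 * ε) (φ := fun δ => L ((ε + δ : ℝ) + β * I))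
      (analyticAt_riemannZeta_affine (b := ε + β * I) (fun h => by
        have := congrArg re h
        simp at this
        linarith) 1) (by linarith)
      (hLc.comp (by fun_prop) fun δ hδ => ⟨by linarith [hδ.1], by linarith [hδ.2]⟩)
      (fun δ hδ => by
        rw [he _ (mem_hseg ⟨by linarith [hδ.1], by linarith [hδ.2]⟩)]
        congr 1
        push_cast
        ring)
    have hsh : Tendsto (fun τ : ℝ => τ - ε) (𝓝[>] ε) (𝓝[>] 0) := by
      refine tendsto_nhdsWithin_iff.2 ⟨?_, ?_⟩
      · have := ((continuous_id.sub continuous_const).tendsto (f := fun τ : ℝ => τ - ε) ε)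
        rw [sub_self] at this
        exact this.mono_left nhdsWithin_le_nhds
      · filter_upwards [self_mem_nhdsWithin] with x hx using sub_pos.2 (Set.mem_Ioi.1 hx)
    refine (key.comp hsh).congr fun τ => ?_
    simp
  rcases eq_or_lt_of_le hτ.2 with rfl | h2
  · rw [continuousWithinAt_Icc_iff_Iic hlt, ← continuousWithinAt_Iio_iff_Iic, ContinuousWithinAt,
      hmu1, ofReal_zero, mul_zero]
    refine tendsto_mul_mu hε hmu1 ?_
    have key := tendsto_mul_log_branch (η := 1 - 2 * ε)
      (φ := fun δ => L ((1 - ε - δ : ℝ) + β * I))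
      (analyticAt_riemannZeta_affine (b := 1 - ε + β * I) (fun h => by
        have := congrArg re h
        simp at this
        linarith) (-1)) (by linarith)
      (hLc.comp (by fun_prop) fun δ hδ => ⟨by linarith [hδ.2], by linarith [hδ.1]⟩)
      (fun δ hδ => by
        rw [he _ (mem_hseg ⟨by linarith [hδ.2], by linarith [hδ.1]⟩)]
        congr 1
        push_cast
        ring)
    have hsh : Tendsto (fun τ : ℝ => 1 - ε - τ) (𝓝[<] (1 - ε)) (𝓝[>] 0) := by
      refine tendsto_nhdsWithin_iff.2 ⟨?_, ?_⟩
      · have := ((continuous_const.sub continuous_id).tendsto (f := fun τ : ℝ => 1 - ε - τ)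
          (1 - ε))
        rw [sub_self] at this
        exact this.mono_left nhdsWithin_le_nhds
      · filter_upwards [self_mem_nhdsWithin] with x hx using sub_pos.2 (Set.mem_Iio.1 hx)
    have := (key.comp hsh).neg
    rw [neg_zero] at this
    refine this.congr fun τ => ?_
    simp only [Function.comp, sub_sub_cancel]
    rw [← neg_mul, ← ofReal_neg, neg_sub]
  · exact ((hLc.continuousAt (Ioo_mem_nhds h1 h2)).mul hmu.continuousAt).continuousWithinAt

theorem continuousOn_Qeps (hm : 0 < m) (hε : 2 / (m : ℝ) < ε) (hε' : ε < 1 / 2)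
    (hc : ContinuousOn L (hseg ε β)) (he : ∀ z ∈ hseg ε β, exp (L z) = riemannZeta z) :
    ContinuousOn (fun τ : ℝ => Qeps L m ε (τ + β * I)) (Set.Icc ε (1 - ε)) := by
  have hε0 : 0 < ε := lt_of_le_of_lt (by positivity) hε
  have hmu : Continuous fun τ : ℝ => (mu ε τ : ℂ) := continuous_ofReal.comp (continuous_mu hε0)
  have htail : ContinuousOn (fun τ : ℝ => primeTail m (τ + β * I)) (Set.Icc ε (1 - ε)) :=
    (continuousOn_primeTail hm hε).comp (by fun_prop) fun τ hτ => by simpa using hτ.1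
  refine ((continuousOn_log_mul_mu hε0 hε' hc he).sub (htail.mul hmu.continuousOn)).congr
    fun τ _ => ?_
  simp [Qeps, Qm, sub_mul]

theorem isPreconnected_hseg : IsPreconnected (hseg ε β) := by
  have h : hseg ε β = (fun τ : ℝ => (τ : ℂ) + β * I) '' Set.Ioo ε (1 - ε) := by
    ext z
    constructor
    · rintro ⟨h1, h2, h3⟩
      exact ⟨z.re, ⟨h1, h2⟩, by rw [← h3]; exact re_add_im z⟩
    · rintro ⟨τ, hτ, rfl⟩
      exact mem_hseg hτ
  rw [h]
  exact isPreconnected_Ioo.image _ (by fun_prop)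

end Segment

/-! ### The functional equation for `Q_ε` and its Fourier integrals. -/

section Branch

variable {L : ℂ → ℂ} {m : ℕ} {ε α : ℝ}

theorem one_sub_mem_hseg {z : ℂ} (hz : z ∈ hseg ε α) : 1 - z ∈ hseg ε (-α) := by
  obtain ⟨h1, h2, h3⟩ := hz
  refine ⟨?_, ?_, ?_⟩
  · simp; linarith
  · simpa using h1
  · simpa using h3

/-- The branch satisfies the logarithm of Riemann's functional equation on the whole segment. -/
theorem IsLogZetaBranch.eqOn (hL : IsLogZetaBranch L ε α) (hε : 0 < ε) :
    ∀ z ∈ hseg ε α, L z = L (1 - z) + F z := by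
  obtain ⟨z₀, hz₀, h₀⟩ := hL.normalized
  have hstrip : hseg ε α ⊆ {s : ℂ | 0 < s.re ∧ s.re < 1} := fun s hs =>
    ⟨by linarith [hs.1], by linarith [hs.2.1]⟩
  refine eqOn_of_exp_eqOn isPreconnected_hseg (hL.continuousOn.mono Set.subset_union_left)
    ((hL.continuousOn.comp (by fun_prop) fun z hz => .inr (one_sub_mem_hseg hz)).add
      (continuousOn_F.mono hstrip)) (fun z hz => ?_) hz₀ h₀
  have h1 := (hstrip hz)
  rw [exp_add, hL.exp_eq z (.inl hz), hL.exp_eq _ (.inr (one_sub_mem_hseg hz))]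
  exact riemannZeta_eq_mul_exp_F h1.1 h1.2

theorem IsLogZetaBranch.Feps_eq (hL : IsLogZetaBranch L ε α) (hε : 0 < ε) {τ : ℝ}
    (hτ : τ ∈ Set.Icc ε (1 - ε)) :
    Feps m ε (τ + α * I) = Qeps L m ε (τ + α * I) - Qeps L m ε (((1 - τ : ℝ) : ℂ) - α * I) := by
  have e1 : ((τ : ℂ) + α * I).re = τ := by simp
  have e2 : (((1 - τ : ℝ) : ℂ) - α * I).re = 1 - τ := by simp
  have e3 : ((1 - τ : ℝ) : ℂ) - α * I = 1 - (τ + α * I) := by push_cast; ring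
  rw [Feps, Qeps, Qeps, e1, e2, mu_one_sub, ← sub_mul]
  -- At the endpoints the logarithmic functional equation is not available, but every term carries
  -- the factor `μ_ε = 0`.
  rcases eq_or_lt_of_le hτ.1 with rfl | h1
  · simp [mu_self hε]
  rcases eq_or_lt_of_le hτ.2 with rfl | h2
  · simp [mu_one_sub, mu_self hε]
  rw [e3, Fm, Qm, Qm, hL.eqOn hε _ (mem_hseg ⟨h1, h2⟩)]
  ring

theorem Jeps_eq (L : ℂ → ℂ) (m : ℕ) (ε α : ℝ) (k : ℂ) :
    Jeps L m ε α k = 1 / (Real.sqrt (2 * Real.pi) : ℂ) *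
      fourierLaplace (fun τ : ℝ => Qeps L m ε (τ - α * I)) ε (1 - ε) k := rfl

/-- `I_ε - F̃_ε` as a Fourier–Laplace integral of the reflected function. -/
theorem IsLogZetaBranch.Ieps_sub_Ftilde (hL : IsLogZetaBranch L ε α) (hε : 0 < ε)
    (hε' : ε < 1 / 2)
    (hI : IntervalIntegrable (fun τ : ℝ => Qeps L m ε (τ + α * I)) volume ε (1 - ε))
    (hF : IntervalIntegrable (fun τ : ℝ => Feps m ε (τ + α * I)) volume ε (1 - ε)) (k : ℂ) :
    Ieps L m ε α k - Ftilde m ε α k = 1 / (Real.sqrt (2 * Real.pi) : ℂ) *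
      fourierLaplace (fun τ : ℝ => Qeps L m ε (((1 - τ : ℝ) : ℂ) - α * I)) ε (1 - ε) (-k) := by
  rw [Ieps, Ftilde, ← mul_sub, fourierLaplace,
    ← intervalIntegral.integral_sub (hI.mul_continuousOn (by fun_prop))
      (hF.mul_continuousOn (by fun_prop))]
  congr 1
  refine intervalIntegral.integral_congr fun τ hτ => ?_
  rw [Set.uIcc_of_le (by linarith)] at hτ
  simp only [hL.Feps_eq hε hτ]
  rw [← sub_mul, sub_sub_cancel]
  congr 2
  ring

/-- The substitution `τ ↦ 1 - τ` maps `[ε, 1 - ε]` to itself and releases the factor `e^{-ik}`,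
which is the numerator in `R`. -/
theorem fourierLaplace_reflect (q : ℝ → ℂ) (ε : ℝ) (k : ℂ) :
    fourierLaplace (fun τ => q (1 - τ)) ε (1 - ε) (-k) =
      exp (-I * k) * fourierLaplace q ε (1 - ε) k := by
  have h := intervalIntegral.integral_comp_sub_left (a := ε) (b := 1 - ε)
    (fun τ : ℝ => exp (-I * k) * (q τ * exp (I * k * τ))) 1
  rw [sub_sub_cancel] at h
  rw [fourierLaplace, fourierLaplace, ← intervalIntegral.integral_const_mul, ← h]
  refine intervalIntegral.integral_congr fun τ _ => ?_
  rw [mul_left_comm, ← exp_add]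
  congr 2
  push_cast
  ring

end Branch

end ZetaRH

/-! ### Assembly of the theorem. -/

theorem theorem3 (a : ℝ) (ha : 2 < a) (m : ℕ) (hm : 0 < m) (ε α : ℝ) (hε : 2 / (m : ℝ) < ε)
    (s : ℕ → ℂ) (hs : ∀ j, riemannZeta (s j) = 0 ∧ 0 < (s j).re ∧ (s j).re < 1)
    (n : ℕ) (hα : (3 / 4 + α * Complex.I : ℂ) ∈ ZetaRH.D s n ε)
    (L : ℂ → ℂ) (hL : ZetaRH.IsLogZetaBranch L ε α) :
    -- the Fourier integrals converge absolutely
    (IntervalIntegrable (fun τ : ℝ => ZetaRH.Qeps L m ε ((τ : ℂ) + α * Complex.I))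
        MeasureTheory.volume ε (1 - ε) ∧
      IntervalIntegrable (fun τ : ℝ => ZetaRH.Qeps L m ε ((τ : ℂ) - α * Complex.I))
        MeasureTheory.volume ε (1 - ε) ∧
      IntervalIntegrable (fun τ : ℝ => ZetaRH.Feps m ε ((τ : ℂ) + α * Complex.I))
        MeasureTheory.volume ε (1 - ε)) ∧
    -- the Riemann–Hilbert problem with coefficient R
    ZetaRH.IsRHSolution (fun k : ℝ => ZetaRH.R a k) (fun k : ℝ => -ZetaRH.Jeps L m ε α k)
      (fun k => ZetaRH.Jeps L m ε α k)
      (fun k => (ZetaRH.Ieps L m ε α k - ZetaRH.Ftilde m ε α k) / (k - a * Complex.I)) ∧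
    -- the canonical factors exist and factorize R
    (∀ k : ℝ, ZetaRH.TplusExists (ZetaRH.lnR a) k ∧ ZetaRH.TminusExists (ZetaRH.lnR a) k ∧
      ZetaRH.R a k = ZetaRH.Xminus a k / ZetaRH.Xplus a k) ∧
    -- the Cauchy–Plemelj formulas, with G = J
    (∀ k : ℝ,
      ZetaRH.TplusExists (fun t : ℝ => ZetaRH.Jeps L m ε α t / ZetaRH.Xminus a t) k ∧
      ZetaRH.Jeps L m ε α k =
        ZetaRH.Xplus a k *
          ZetaRH.Tplus (fun t : ℝ => ZetaRH.Jeps L m ε α t / ZetaRH.Xminus a t) k) ∧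
    (∀ k : ℝ,
      ZetaRH.TminusExists (fun t : ℝ => ZetaRH.Jeps L m ε α t / ZetaRH.Xminus a t) k ∧
      (ZetaRH.Ieps L m ε α k - ZetaRH.Ftilde m ε α k) / ((k : ℂ) - a * Complex.I) =
        ZetaRH.Xminus a k *
          ZetaRH.Tminus (fun t : ℝ => ZetaRH.Jeps L m ε α t / ZetaRH.Xminus a t) k) := by
  have hε0 : 0 < ε := lt_of_le_of_lt (by positivity) hε
  -- Membership of `3/4 + iα` in `D` gives `3/4 < 1 - ε`.
  have hε' : ε < 1 / 2 := by
    have h1 := hα.2.1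
    simp at h1
    linarith
  have ha0 : 0 < a := by linarith
  have hle : ε ≤ 1 - ε := by linarith
  have hle1 : 1 - ε ≤ 1 := by linarith
  have cI := ZetaRH.continuousOn_Qeps hm hε hε' (hL.continuousOn.mono Set.subset_union_left)
    fun z hz => hL.exp_eq z (.inl hz)
  have cJ : ContinuousOn (fun τ : ℝ => ZetaRH.Qeps L m ε ((τ : ℂ) - α * Complex.I))
      (Set.Icc ε (1 - ε)) := by
    refine (ZetaRH.continuousOn_Qeps hm hε hε' (hL.continuousOn.mono Set.subset_union_right)
      fun z hz => hL.exp_eq z (.inr hz)).congr fun τ _ => ?_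
    simp [sub_eq_add_neg]
  have cJ' : ContinuousOn (fun τ : ℝ => ZetaRH.Qeps L m ε (((1 - τ : ℝ) : ℂ) - α * Complex.I))
      (Set.Icc ε (1 - ε)) :=
    cJ.comp (f := fun τ : ℝ => 1 - τ) (by fun_prop) fun τ hτ =>
      ⟨by linarith [hτ.2], by linarith [hτ.1]⟩
  have cF : ContinuousOn (fun τ : ℝ => ZetaRH.Feps m ε ((τ : ℂ) + α * Complex.I))
      (Set.Icc ε (1 - ε)) := (cI.sub cJ').congr fun τ hτ => hL.Feps_eq hε0 hτ
  have iI := cI.intervalIntegrable_of_Icc (μ := MeasureTheory.volume) hle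
  have iJ := cJ.intervalIntegrable_of_Icc (μ := MeasureTheory.volume) hle
  have iJ' := cJ'.intervalIntegrable_of_Icc (μ := MeasureTheory.volume) hle
  have iF := cF.intervalIntegrable_of_Icc (μ := MeasureTheory.volume) hle
  have hJ : ZetaRH.IsUpperBoundary fun k => ZetaRH.Jeps L m ε α k :=
    ZetaRH.isUpperBoundary_fourierLaplace hε0.le hle hle1 cJ _
  have hdiff := hL.Ieps_sub_Ftilde (m := m) hε0 hε' iI iF
  set g : ℂ → ℂ := fun k =>
    (ZetaRH.Ieps L m ε α k - ZetaRH.Ftilde m ε α k) / (k - a * Complex.I) with hg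
  have hgd : ∀ w : ℂ, w.im ≤ 0 → DifferentiableAt ℂ g w := fun w hw => by
    simp only [hg, hdiff]
    refine DifferentiableAt.div ?_ (by fun_prop) (ZetaRH.sub_mul_I_ne_zero ha0 hw)
    exact ((ZetaRH.differentiable_fourierLaplace hε0.le hle hle1 iJ').comp
      differentiable_neg).differentiableAt.const_mul _
  have hgC : ∀ w : ℂ, w.im ≤ 0 → ‖g w‖ ≤ (‖1 / (Real.sqrt (2 * Real.pi) : ℂ)‖ *
      ∫ τ in ε..(1 - ε), ‖ZetaRH.Qeps L m ε (((1 - τ : ℝ) : ℂ) - α * Complex.I)‖) *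
      ‖(w - a * Complex.I)⁻¹‖ := fun w hw => by
    simp only [hg, hdiff]
    rw [div_eq_mul_inv, norm_mul, norm_mul]
    gcongr
    exact ZetaRH.norm_fourierLaplace_le hε0.le hle iJ' (by simpa using hw)
  -- After reflection, `g = e^{-ik} J / (k - ia)`, which is `(R - 1) J`.
  have hjump : ∀ k : ℝ, g k = ZetaRH.R a k * ZetaRH.Jeps L m ε α k - ZetaRH.Jeps L m ε α k := by
    intro k
    have hk := ZetaRH.sub_mul_I_ne_zero ha0 (w := k) (by simp)
    simp only [hg, hdiff]
    rw [ZetaRH.fourierLaplace_reflect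
      (fun τ : ℝ => ZetaRH.Qeps L m ε ((τ : ℂ) - α * Complex.I)) ε k, ZetaRH.Jeps_eq, ZetaRH.R]
    field_simp
    ring
  have hgl := ZetaRH.isLowerBoundary_of_norm_le ha0 hgd hgC
  have hmain := ZetaRH.plemelj_of_jump ha hJ hgd hgC hjump
  refine ⟨⟨iI, iJ, iF⟩, ?_, fun k => ⟨(ZetaRH.tplus_lnR ha k).1, (ZetaRH.tminus_lnR ha k).1, ?_⟩,
    fun k => (hmain k).1, fun k => (hmain k).2⟩
  · exact ⟨hJ.holo, hgl.holo, hJ.cont, hgl.cont, fun k => by rw [hjump k, sub_eq_add_neg],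
      hJ.decay, hgl.decay⟩
  · rw [ZetaRH.Xplus_eq_one ha, ZetaRH.Xminus_eq_R ha, div_one]
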